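/- Call a set $S\subseteq\mathbb N$ recursively enumerable (r.e.) if it is the range of a partial recursive function $\mathbb N\rightharpoonup\mathbb N$. Let $f_0,f_1,f_2,\dots$ be the standard effective enumeration of all partial recursive functions of one variable, let $\langle\cdot,\cdot\rangle:\mathbb N^2\to\mathbb N$ be a computable pairing bijection, and let $H=\{\langle n,x\rangle : f_n(x)\text{ is defined}\}$ be the halting set. Let PA be first-order Peano Arithmetic in the language $\{0,S,+,\cdot\}$ with equality: the usual postulates for $0,S,+,\cdot$ and the induction schema for all formulas of the language, together with a Hilbert-style calculus for classical first-order logic with equality. For a formula $P(x)$ of this language with at most the one free variable $x$, let $P_n$ be the sentence obtained by substituting the numeral $S^n0$ for $x$; say that $P$ expresses the statement "$n\notin K$" if, for every $n\in\mathbb N$, the sentence $P_n$ is true in the standard model $\mathbb N$ if and only if $n\notin K$. **Theorem (Incompleteness Theorem).** The set $H$ is r.e. and its complement is not r.e. Moreover, for every r.e. set $K\subseteq\mathbb N$ whose complement is not r.e. (in particular for $K=H$): 1. there is a formula $P(x)$ in the language of PA that expresses the statement "$n\notin K$"; 2. for every such formula $P(x)$ there is $n_0\in\mathbb N$ such that $n_0\notin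 K$ is true but the sentence $P_{n_0}$ is not provable in PA. -/

import Mathlib

open FirstOrder FirstOrder.Language

namespace PeanoIncompleteness

/-! ### Recursively enumerable sets and the halting set -/

/-- A set of natural numbers is recursively enumerable if it is the range of a (partial)
recursive function. -/
def IsRecursivelyEnumerable (S : Set ℕ) : Prop :=
  ∃ f : ℕ →. ℕ, Nat.Partrec f ∧ f.ran = S

/-- The effective list `f 0, f 1, f 2, …` of all partial recursive functions of one variable. -/
def partialRecursive (n : ℕ) : ℕ →. ℕ :=
  (Denumerable.ofNat Nat.Partrec.Code n).eval

/-- The set of (codes of) pairs `(n, x)` such that the `n`-th partial recursive function converges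
at `x`. -/
def haltingSet : Set ℕ :=
  {m | ∃ n x : ℕ, (partialRecursive n x).Dom ∧ Nat.pair n x = m}

/-! ### The first-order language of arithmetic and its standard model -/

/-- The function symbols of arithmetic: zero, successor, addition, multiplication. -/
inductive ArithFunc : ℕ → Type
  | zero : ArithFunc 0
  | succ : ArithFunc 1
  | add : ArithFunc 2
  | mul : ArithFunc 2

/-- The first-order language of arithmetic (equality is a logical symbol). -/
def arith : FirstOrder.Language.{0, 0} :=
  { Functions := ArithFunc
    Relations := fun _ => Empty }

section Terms

variable {α : Type}

/-- The term `0`. -/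
def tZero : arith.Term α := Constants.term (L := arith) ArithFunc.zero

/-- The term `S t`. -/
def tSucc (t : arith.Term α) : arith.Term α := Functions.apply₁ (L := arith) ArithFunc.succ t

/-- The term `s + t`. -/
def tAdd (s t : arith.Term α) : arith.Term α := Functions.apply₂ (L := arith) ArithFunc.add s t

/-- The term `s · t`. -/
def tMul (s t : arith.Term α) : arith.Term α := Functions.apply₂ (L := arith) ArithFunc.mul s t

/-- The numeral `S (S (… (S 0)))` of a natural number. -/
def numeral : ℕ → arith.Term α
  | 0 => tZero
  | n + 1 => tSucc (numeral n)

end Terms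

/-- The standard model: the natural numbers with their usual operations. -/
instance standardModel : arith.Structure ℕ where
  funMap := fun {_} f =>
    match f with
    | ArithFunc.zero => fun _ => 0
    | ArithFunc.succ => fun v => v 0 + 1
    | ArithFunc.add => fun v => v 0 + v 1
    | ArithFunc.mul => fun v => v 0 * v 1
  RelMap := fun {_} r => r.elim

/-! ### Formal provability

Formulas have free variables `fv 0, fv 1, fv 2, …` (type `ℕ`). A term of `arith.BoundedFormula ℕ 1` is
a formula with one further variable, the one that a quantifier put in front of it would bind. -/

/-- `instantiate φ t` is `φ(t)`: the distinguished variable of `φ` is replaced by the term `t`. -/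
def instantiate (φ : arith.BoundedFormula ℕ 1) (t : arith.Term ℕ) : arith.Formula ℕ :=
  φ.toFormula.subst (Sum.elim Term.var fun _ => t)

/-- `atSucc φ` is `φ(S y)`, where `y` is the distinguished variable of `φ`, which is again the
distinguished variable of the result. -/
def atSucc (φ : arith.BoundedFormula ℕ 1) : arith.BoundedFormula ℕ 1 :=
  BoundedFormula.relabel (n := 1) (k := 0) id
    (φ.toFormula.subst (Sum.elim (fun i => Term.var (Sum.inl i))
      fun j => tSucc (Term.var (Sum.inr j))))

/-- The variable `fv i`. -/
def fv (i : ℕ) : arith.Term ℕ := Term.var i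

/-- The non-logical postulates of first-order Peano Arithmetic, stated as open formulas (which, by
the rules for the quantifier below, amount to their universal closures). In the induction schema,
`φ` ranges over all formulas of the language, possibly with parameters. -/
inductive PeanoPostulate : arith.Formula ℕ → Prop
  | succ_ne_zero : PeanoPostulate ((tSucc (fv 0)).equal tZero).not
  | succ_inj : PeanoPostulate
      (((tSucc (fv 0)).equal (tSucc (fv 1))).imp ((fv 0).equal (fv 1)))
  | add_zero : PeanoPostulate ((tAdd (fv 0) tZero).equal (fv 0))
  | add_succ : PeanoPostulate
      ((tAdd (fv 0) (tSucc (fv 1))).equal (tSucc (tAdd (fv 0) (fv 1))))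
  | mul_zero : PeanoPostulate ((tMul (fv 0) tZero).equal tZero)
  | mul_succ : PeanoPostulate
      ((tMul (fv 0) (tSucc (fv 1))).equal (tAdd (tMul (fv 0) (fv 1)) (fv 0)))
  | induction (φ : arith.BoundedFormula ℕ 1) : PeanoPostulate
      ((instantiate φ tZero).imp (((φ.imp (atSucc φ)).all).imp φ.all))

/-- The theorems of Peano Arithmetic, in a Hilbert-style calculus for classical first-order logic
with equality (with `⊥`, `→`, `∀`, `=` as primitive logical symbols). -/
inductive PADerivable : arith.Formula ℕ → Prop
  /-- non-logical postulates -/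
  | postulate {φ : arith.Formula ℕ} : PeanoPostulate φ → PADerivable φ
  /-- `φ → (ψ → φ)` -/
  | weaken (φ ψ : arith.Formula ℕ) : PADerivable (φ.imp (ψ.imp φ))
  /-- `(φ → (ψ → χ)) → ((φ → ψ) → (φ → χ))` -/
  | distrib (φ ψ χ : arith.Formula ℕ) :
      PADerivable ((φ.imp (ψ.imp χ)).imp ((φ.imp ψ).imp (φ.imp χ)))
  /-- `¬¬φ → φ` -/
  | double_neg (φ : arith.Formula ℕ) : PADerivable (φ.not.not.imp φ)
  /-- `∀ y, φ(y) → φ(t)` -/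
  | specialize (φ : arith.BoundedFormula ℕ 1) (t : arith.Term ℕ) :
      PADerivable (φ.all.imp (instantiate φ t))
  /-- `t = t` -/
  | eq_refl (t : arith.Term ℕ) : PADerivable (t.equal t)
  /-- `s = t → (φ(s) → φ(t))` -/
  | eq_subst (φ : arith.BoundedFormula ℕ 1) (s t : arith.Term ℕ) :
      PADerivable ((s.equal t).imp ((instantiate φ s).imp (instantiate φ t)))
  /-- modus ponens -/
  | mp {φ ψ : arith.Formula ℕ} : PADerivable (φ.imp ψ) → PADerivable φ → PADerivable ψ
  /-- generalization: from `χ → φ(fv i)` infer `χ → ∀ y, φ(y)`, if `fv i` is free neither in `χ` nor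
  in `φ` -/
  | generalize {χ : arith.Formula ℕ} {φ : arith.BoundedFormula ℕ 1} (i : ℕ) :
      i ∉ BoundedFormula.freeVarFinset χ → i ∉ φ.freeVarFinset →
      PADerivable (χ.imp (instantiate φ (fv i))) → PADerivable (χ.imp φ.all)

/-- A sentence is provable in Peano Arithmetic. -/
def PAProves (σ : arith.Sentence) : Prop :=
  PADerivable (Formula.relabel Empty.elim σ)

/-! ### Sentences about membership in a set -/

/-- For a formula `φ` in one variable, the sentence `φ(n)` obtained by inserting the numeral
of `n`. -/
def instanceAt (φ : arith.Formula (Fin 1)) (n : ℕ) : arith.Sentence :=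
  BoundedFormula.subst φ fun _ => numeral n

/-- The formula `φ` in one variable says "`n ∈ S`" in the language of arithmetic: in the standard
model the sentence `φ(n)` is true exactly for the members `n` of `S`. -/
def Expresses (φ : arith.Formula (Fin 1)) (S : Set ℕ) : Prop :=
  ∀ n : ℕ, (ℕ ⊨ instanceAt φ n) ↔ n ∈ S

end PeanoIncompleteness

/-!
If every true instance of a formula `P` expressing `n ∉ K` were provable, then, because provable
sentences are true, the complement of `K` would be the set of all `n` for which the instance of `P`
at `n` is provable. That set is recursively enumerable, so the complement of `K` would be too.

To enumerate the theorems it is enough to have a recursively enumerable set of true sentences that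
contains all theorems (`exists_rePred_between`). Terms and formulas are coded by binary trees, and
three judgements on codes, "`φ` is provable", "substitution turns `e` into `e'`" and "`y` does not
occur in `e`", are generated by finitely many Horn rules over tree patterns (`RuleName.rule`). The
consequences of finitely many Horn rules can be enumerated by a primitive recursive search
(`rePred_derives`). Every tree has a value under every assignment (`CodeTree.eval`), whether or not
it is the code of an expression, so each judgement has a semantic content, which the rules preserve
(`RuleName.sound`). The rules simulate the calculus of Peano Arithmetic (`der_of_paDerivable`). Here
it matters how bound variables are named: the name is the height of the scope of the quantifier.
Coding then commutes with relabelling and substitution (`code_relabel`, `code_subst`,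
`code_toFormula`), and naive substitution into a code captures no variable (`der_sub_code`).

That a recursively enumerable set and its complement are arithmetical follows by induction on
the construction of partial recursive functions, with Gödel's beta function coding the values of a
primitive recursion (`arithmeticalGraph_of_partrec`).
-/

namespace PeanoIncompleteness

/-! ### Recursively enumerable sets as recursively enumerable predicates -/

theorem rePred_exists {α : Type*} [Primcodable α] {R : α → ℕ → Prop}
    (h : ComputablePred fun p : α × ℕ => R p.1 p.2) : REPred fun a => ∃ n, R a n := by
  classical
  have : Partrec fun a => Nat.rfind fun n => Part.some (decide (R a n)) :=
    Partrec.rfind h.decide.partrec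
  refine this.dom_re.of_eq fun a => ?_
  refine Nat.rfind_dom.trans ⟨fun ⟨n, h, _⟩ => ⟨n, by simpa using h⟩, fun ⟨n, h⟩ => ?_⟩
  exact ⟨n, by simpa using h, fun _ => trivial⟩

/-- The range of a partial recursive function is the domain of a search through all pairs of a
number of steps and an argument. -/
theorem isRecursivelyEnumerable_iff {S : Set ℕ} :
    IsRecursivelyEnumerable S ↔ REPred fun n => n ∈ S := by
  constructor
  · rintro ⟨f, hf, rfl⟩
    obtain ⟨c, rfl⟩ := Nat.Partrec.Code.exists_code.1 hf
    have h : ComputablePred fun p : ℕ × ℕ =>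
        Nat.Partrec.Code.evaln p.2.unpair.1 c p.2.unpair.2 = some p.1 := by
      refine PrimrecPred.computablePred (PrimrecRel.comp Primrec.eq ?_ ?_)
      · exact Nat.Partrec.Code.primrec_evaln.comp
          (((Primrec.fst.comp (Primrec.unpair.comp Primrec.snd)).pair (Primrec.const c)).pair
            (Primrec.snd.comp (Primrec.unpair.comp Primrec.snd)))
      · exact Primrec.option_some.comp Primrec.fst
    refine (rePred_exists (R := fun y k =>
      Nat.Partrec.Code.evaln k.unpair.1 c k.unpair.2 = some y) h).of_eq fun y => ?_
    constructor
    · rintro ⟨k, hk⟩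
      exact ⟨_, Nat.Partrec.Code.evaln_sound hk⟩
    · rintro ⟨x, hx⟩
      obtain ⟨k, hk⟩ := Nat.Partrec.Code.evaln_complete.1 hx
      exact ⟨Nat.pair k x, by simpa using hk⟩
  · intro h
    refine ⟨_, Partrec.nat_iff.1 (h.map (g := fun a _ => a) Computable.fst.to₂), ?_⟩
    ext y
    simp [PFun.ran]

/-! ### Trees as codes -/

/-- Finite binary trees, the codes of terms, formulas and judgements. -/
inductive CodeTree : Type
  | leaf : CodeTree
  | node : CodeTree → CodeTree → CodeTree
  deriving DecidableEq

namespace CodeTree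

/-- The number of a tree: `0` for a leaf, and one more than the number of the pair of the numbers
of the two subtrees for a node. -/
def toNat : CodeTree → ℕ
  | leaf => 0
  | node a b => Nat.pair a.toNat b.toNat + 1

/-- The tree with a given number. -/
def ofNat : ℕ → CodeTree
  | 0 => leaf
  | n + 1 => node (ofNat n.unpair.1) (ofNat n.unpair.2)
decreasing_by
  · exact Nat.lt_succ_of_le (Nat.unpair_left_le n)
  · exact Nat.lt_succ_of_le (Nat.unpair_right_le n)

theorem ofNat_toNat (t : CodeTree) : ofNat t.toNat = t := by
  induction t with
  | leaf => simp [toNat, ofNat]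
  | node a b iha ihb => simp [toNat, ofNat, iha, ihb]

theorem toNat_ofNat (n : ℕ) : (ofNat n).toNat = n := by
  induction n using Nat.strong_induction_on with
  | _ n ih =>
    cases n with
    | zero => simp [toNat, ofNat]
    | succ n =>
      rw [ofNat, toNat, ih _ (Nat.lt_succ_of_le (Nat.unpair_left_le n)),
        ih _ (Nat.lt_succ_of_le (Nat.unpair_right_le n)), Nat.pair_unpair]

/-- Trees correspond to natural numbers. -/
def equivNat : CodeTree ≃ ℕ := ⟨toNat, ofNat, ofNat_toNat, toNat_ofNat⟩

instance : Primcodable CodeTree := Primcodable.ofEquiv ℕ equivNat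

theorem primrec_node : Primrec₂ node := by
  have h1 : Primrec toNat := Primrec.of_equiv (e := equivNat)
  have h2 : Primrec ofNat := Primrec.of_equiv_symm (e := equivNat)
  have : Primrec₂ fun a b : CodeTree => ofNat (Nat.pair a.toNat b.toNat + 1) :=
    h2.comp (Primrec.succ.comp (Primrec₂.natPair.comp (h1.comp Primrec.fst) (h1.comp Primrec.snd)))
  refine this.of_eq fun a b => ?_
  simp [ofNat, ofNat_toNat]

end CodeTree

/-! ### Horn rules -/

/-- Trees with variables. -/
inductive TreePattern : Type
  | var (i : ℕ) : TreePattern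
  | leaf : TreePattern
  | node : TreePattern → TreePattern → TreePattern

/-- The instance of a pattern under an assignment of trees to its variables. -/
def TreePattern.inst (σ : ℕ → CodeTree) : TreePattern → CodeTree
  | var i => σ i
  | leaf => .leaf
  | node p q => .node (p.inst σ) (q.inst σ)

/-- A Horn rule: from all instances of the premises under an assignment infer the instance of the
conclusion under the same assignment. -/
structure HornRule where
  /-- The premises. -/
  prems : List TreePattern
  /-- The conclusion. -/
  concl : TreePattern

/-- The trees that are derivable from a list of Horn rules. -/
inductive Derives (R : List HornRule) : CodeTree → Prop
  | step {r : HornRule} (hr : r ∈ R) (σ : ℕ → CodeTree)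
      (h : ∀ p ∈ r.prems, Derives R (p.inst σ)) : Derives R (r.concl.inst σ)

/-- The assignment given by a list of trees; variables beyond the list become leaves. -/
def listAssign (l : List CodeTree) (i : ℕ) : CodeTree := l.getD i .leaf

/-- The list `S` extended by the conclusions of those rules in `R` that apply to members of `S`
under the assignment `listAssign l`. -/
def fire (S l : List CodeTree) : List HornRule → List CodeTree
  | [] => S
  | r :: R => if ∀ p ∈ r.prems, p.inst (listAssign l) ∈ S
      then r.concl.inst (listAssign l) :: fire S l R else fire S l R

theorem mem_fire {S l : List CodeTree} {R : List HornRule} {t : CodeTree} :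
    t ∈ fire S l R ↔ t ∈ S ∨ ∃ r ∈ R, (∀ p ∈ r.prems, p.inst (listAssign l) ∈ S) ∧
      t = r.concl.inst (listAssign l) := by
  induction R with
  | nil => simp [fire]
  | cons r R ih =>
    rw [fire]
    split_ifs with h
    · simp only [List.mem_cons, ih, exists_eq_or_imp]
      tauto
    · simp only [List.mem_cons, ih, exists_eq_or_imp]
      tauto

/-- The trees derived by the first `n` steps of a systematic search. Step `n` uses the assignment
coded by the second component of `n`, so that each assignment recurs infinitely often. -/
def stage (R : List HornRule) : ℕ → List CodeTree
  | 0 => []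
  | n + 1 => fire (stage R n) ((Encodable.decode n.unpair.2).getD []) R

theorem stage_mono (R : List HornRule) {m n : ℕ} (h : m ≤ n) : stage R m ⊆ stage R n := by
  induction n, h using Nat.le_induction with
  | base => exact fun _ h => h
  | succ n _ ih => exact fun t ht => mem_fire.2 (Or.inl (ih ht))

/-- Only finitely many variables matter for an instance, so a list suffices as an assignment. -/
theorem TreePattern.exists_list (p : TreePattern) (σ : ℕ → CodeTree) :
    ∃ N, ∀ n, N ≤ n → p.inst (listAssign (List.ofFn fun i : Fin n => σ i)) = p.inst σ := by
  induction p with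
  | var i =>
    refine ⟨i + 1, fun n hn => ?_⟩
    simp [inst, listAssign, List.getD, show i < n from hn]
  | leaf => exact ⟨0, fun _ _ => rfl⟩
  | node p q ihp ihq =>
    obtain ⟨N, hN⟩ := ihp
    obtain ⟨M, hM⟩ := ihq
    refine ⟨max N M, fun n hn => ?_⟩
    rw [inst, inst, hN n (le_trans (le_max_left _ _) hn), hM n (le_trans (le_max_right _ _) hn)]

theorem derives_iff_mem_stage {R : List HornRule} {t : CodeTree} :
    Derives R t ↔ ∃ n, t ∈ stage R n := by
  constructor
  · intro h
    induction h with
    | @step r hr σ h ih =>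
      have aux : ∀ ps : List TreePattern, (∀ p ∈ ps, ∃ n, p.inst σ ∈ stage R n) →
          ∃ N, ∀ n, N ≤ n → ∀ p ∈ ps, p.inst σ ∈ stage R n ∧
            p.inst (listAssign (List.ofFn fun i : Fin n => σ i)) = p.inst σ := by
        intro ps
        induction ps with
        | nil => exact fun _ => ⟨0, by simp⟩
        | cons p ps ihp =>
          intro hps
          obtain ⟨N, hN⟩ := ihp fun q hq => hps q (by simp [hq])
          obtain ⟨M, hM⟩ := hps p (by simp)
          obtain ⟨K, hK⟩ := p.exists_list σ
          refine ⟨max N (max M K), fun n hn q hq => ?_⟩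
          simp only [max_le_iff] at hn
          rcases List.mem_cons.1 hq with rfl | hq
          · exact ⟨stage_mono R hn.2.1 hM, hK n hn.2.2⟩
          · exact hN n hn.1 q hq
      obtain ⟨N, hN⟩ := aux r.prems ih
      obtain ⟨K, hK⟩ := r.concl.exists_list σ
      set l := List.ofFn fun i : Fin (max N K) => σ i with hl
      have hNl := hN (max N K) (le_max_left _ _)
      -- a step number that codes the assignment `l` and comes after all premises
      refine ⟨Nat.pair (max N K) (Encodable.encode l) + 1, ?_⟩
      rw [stage, mem_fire]
      refine Or.inr ⟨r, hr, ?_, ?_⟩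
      · intro p hp
        rw [Nat.unpair_pair, Encodable.encodek, Option.getD_some, (hNl p hp).2]
        exact stage_mono R (Nat.left_le_pair _ _) (hNl p hp).1
      · rw [Nat.unpair_pair, Encodable.encodek, Option.getD_some, hK _ (le_max_right _ _)]
  · rintro ⟨n, hn⟩
    induction n generalizing t with
    | zero => simp [stage] at hn
    | succ n ih =>
      rw [stage, mem_fire] at hn
      rcases hn with hn | ⟨r, hr, hp, rfl⟩
      · exact ih hn
      · exact .step hr _ fun p h => ih (hp p h)

theorem TreePattern.primrec_inst (p : TreePattern) :
    Primrec fun l : List CodeTree => p.inst (listAssign l) := by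
  induction p with
  | var i => exact (Primrec.list_getD CodeTree.leaf).comp Primrec.id (Primrec.const i)
  | leaf => exact Primrec.const _
  | node p q ihp ihq => exact CodeTree.primrec_node.comp ihp ihq

theorem primrecRel_mem_list {α : Type*} [Primcodable α] [DecidableEq α] :
    PrimrecRel fun (a : α) (l : List α) => a ∈ l := by
  have : PrimrecRel fun (a : α) (l : List α) => ∃ b ∈ l, b = a :=
    (PrimrecRel.exists_mem_list (Primrec.eq (α := α))).swap
  exact this.of_eq fun a l => by simp

theorem primrec_fire (R : List HornRule) :
    Primrec fun p : List CodeTree × List CodeTree => fire p.1 p.2 R := by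
  induction R with
  | nil => exact Primrec.fst
  | cons r R ih =>
    have hp (ps : List TreePattern) : PrimrecPred fun p : List CodeTree × List CodeTree =>
        ∀ q ∈ ps, q.inst (listAssign p.2) ∈ p.1 := by
      induction ps with
      | nil => exact ⟨fun _ => .isTrue (by simp), (Primrec.const true).of_eq fun _ => by simp⟩
      | cons q ps ihp =>
        refine ((primrecRel_mem_list.comp (q.primrec_inst.comp Primrec.snd) Primrec.fst).and
          ihp).of_eq fun _ => by simp
    exact Primrec.ite (hp r.prems)
      (Primrec.list_cons.comp (r.concl.primrec_inst.comp Primrec.snd) ih) ih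

theorem primrec_stage (R : List HornRule) : Primrec (stage R) := by
  have h : Primrec₂ fun (n : ℕ) (S : List CodeTree) =>
      fire S ((Encodable.decode n.unpair.2).getD []) R := by
    refine (primrec_fire R).comp (Primrec.snd.pair (Primrec.option_getD.comp
      (Primrec.decode.comp (Primrec.snd.comp (Primrec.unpair.comp Primrec.fst)))
        (Primrec.const [])))
  refine (Primrec.nat_rec₁ [] h).of_eq fun n => ?_
  induction n with
  | zero => rfl
  | succ n ih => simp only [stage, ← ih]

theorem rePred_derives (R : List HornRule) {t : ℕ → CodeTree} (ht : Primrec t) :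
    REPred fun n => Derives R (t n) := by
  refine (rePred_exists (R := fun n k => t n ∈ stage R k) ?_).of_eq fun n =>
    derives_iff_mem_stage.symm
  exact (primrecRel_mem_list.comp (ht.comp Primrec.fst)
    ((primrec_stage R).comp Primrec.snd)).computablePred

/-! ### Expressions coded by trees -/

namespace CodeTree

/-- The variable with the name `x`. -/
def vr (x : CodeTree) : CodeTree := node leaf x

/-- `∀ x, φ`, for the variable with the name `x`. -/
def all (x φ : CodeTree) : CodeTree := node (node leaf leaf) (node x φ)

/-- The binary operation with the tag `k`, applied to two expressions. -/
def bin (k a b : CodeTree) : CodeTree := node (node (node leaf leaf) k) (node a b)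

/-- The unary numeral of `n` as a tree. -/
def num : ℕ → CodeTree
  | 0 => leaf
  | n + 1 => node leaf (num n)

theorem num_injective : Function.Injective num := by
  intro m
  induction m with
  | zero => intro n h; cases n <;> simp_all [num]
  | succ m ih =>
    intro n h
    cases n with
    | zero => simp [num] at h
    | succ n => simp only [num, node.injEq, true_and] at h; rw [ih h]

/-- The length of the rightmost branch. -/
def depth : CodeTree → ℕ
  | leaf => 0
  | node _ b => b.depth + 1

theorem depth_num (n : ℕ) : (num n).depth = n := by
  induction n with
  | zero => rfl
  | succ n ih => rw [num, depth, ih]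

/-- The term `S t`; the second argument of the operation is a dummy. -/
def su (t : CodeTree) : CodeTree := bin (num 0) t leaf

/-- The term `s + t`. -/
def ad (s t : CodeTree) : CodeTree := bin (num 1) s t

/-- The term `s · t`. -/
def mu (s t : CodeTree) : CodeTree := bin (num 2) s t

/-- The formula `s = t`. -/
def eq (s t : CodeTree) : CodeTree := bin (num 3) s t

/-- The formula `φ → ψ`. -/
def imp (φ ψ : CodeTree) : CodeTree := bin (num 4) φ ψ

open Classical in
/-- The value of the operation with the tag `num k`. Truth values are numbers: zero is false, every
other number is true. -/
noncomputable def opValue (k a b : ℕ) : ℕ :=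
  match k with
  | 0 => a + 1
  | 1 => a + b
  | 2 => a * b
  | 3 => if a = b then 1 else 0
  | _ => if a ≠ 0 → b ≠ 0 then 1 else 0

open Classical in
/-- The value of an expression under an assignment of numbers to the names of variables. Terms and
formulas are not distinguished: the value of a formula is nonzero when it is true, and the leaf is
both the term `0` and the formula `⊥`. Trees that are not expressions have the value zero. -/
noncomputable def eval : CodeTree → (CodeTree → ℕ) → ℕ
  | node leaf x, v => v x
  | node (node leaf _) (node x φ), v => if ∀ n, φ.eval (Function.update v x n) ≠ 0 then 1 else 0
  | node (node (node _ _) k) (node a b), v => opValue k.depth (a.eval v) (b.eval v)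
  | _, _ => 0

variable (v : CodeTree → ℕ)

@[simp] theorem eval_leaf : leaf.eval v = 0 := rfl

@[simp] theorem eval_vr (x : CodeTree) : (vr x).eval v = v x := by simp [vr, eval]

theorem eval_all (x φ : CodeTree) : (all x φ).eval v =
    open Classical in if ∀ n, φ.eval (Function.update v x n) ≠ 0 then 1 else 0 := by
  simp [all, eval]

theorem eval_bin (k a b : CodeTree) :
    (bin k a b).eval v = opValue k.depth (a.eval v) (b.eval v) := by
  simp [bin, eval]

@[simp] theorem eval_all_ne_zero (x φ : CodeTree) :
    (all x φ).eval v ≠ 0 ↔ ∀ n, φ.eval (Function.update v x n) ≠ 0 := by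
  simp [eval_all]

@[simp] theorem eval_su (t : CodeTree) : (su t).eval v = t.eval v + 1 := by
  simp [su, eval_bin, depth_num, opValue]

@[simp] theorem eval_ad (s t : CodeTree) : (ad s t).eval v = s.eval v + t.eval v := by
  simp [ad, eval_bin, depth_num, opValue]

@[simp] theorem eval_mu (s t : CodeTree) : (mu s t).eval v = s.eval v * t.eval v := by
  simp [mu, eval_bin, depth_num, opValue]

@[simp] theorem eval_eq_ne_zero (s t : CodeTree) : (eq s t).eval v ≠ 0 ↔ s.eval v = t.eval v := by
  simp [eq, eval_bin, depth_num, opValue]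

@[simp] theorem eval_imp_ne_zero (φ ψ : CodeTree) :
    (imp φ ψ).eval v ≠ 0 ↔ (φ.eval v ≠ 0 → ψ.eval v ≠ 0) := by
  simp [imp, eval_bin, depth_num, opValue]

/-! ### Judgements and their meaning -/

/-- The judgement that the formula `φ` is provable. -/
def prov (φ : CodeTree) : CodeTree := node leaf φ

/-- The judgement that replacing the variable named `x` by the term `t` turns the expression `e`
into the expression `e'`. -/
def sub (x t e e' : CodeTree) : CodeTree := node (node leaf leaf) (node (node x t) (node e e'))

/-- The judgement that the variable named `y` does not occur in the expression `e`. -/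
def fresh (y e : CodeTree) : CodeTree := node (node leaf (node leaf leaf)) (node y e)

/-- The semantic content of a judgement. -/
def Valid : CodeTree → Prop
  | node leaf φ => ∀ v, φ.eval v ≠ 0
  | node (node leaf leaf) (node (node x t) (node e e')) =>
      ∀ v, e'.eval v = e.eval (Function.update v x (t.eval v))
  | node (node leaf (node _ _)) (node y e) => ∀ v n, e.eval (Function.update v y n) = e.eval v
  | _ => True

@[simp] theorem valid_prov {φ : CodeTree} : (prov φ).Valid ↔ ∀ v, φ.eval v ≠ 0 := by
  simp [prov, Valid]

@[simp] theorem valid_sub {x t e e' : CodeTree} : (sub x t e e').Valid ↔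
    ∀ v, e'.eval v = e.eval (Function.update v x (t.eval v)) := by
  simp [sub, Valid]

@[simp] theorem valid_fresh {y e : CodeTree} : (fresh y e).Valid ↔
    ∀ v n, e.eval (Function.update v y n) = e.eval v := by
  simp [fresh, Valid]

theorem valid_fresh_vr {y x : CodeTree} : (fresh y (vr x)).Valid ↔ y ≠ x := by
  rw [valid_fresh]
  constructor
  · rintro h rfl
    simpa using h (fun _ => 0) 1
  · intro h v n
    simp [Function.update_of_ne (Ne.symm h)]

end CodeTree

/-! ### Derivations as Horn rules -/

namespace TreePattern

/-- The pattern without variables whose only instance is the given tree. -/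
def ofTree : CodeTree → TreePattern
  | .leaf => leaf
  | .node a b => node (ofTree a) (ofTree b)

@[simp] theorem inst_ofTree (σ : ℕ → CodeTree) (t : CodeTree) : (ofTree t).inst σ = t := by
  induction t with
  | leaf => rfl
  | node a b iha ihb => rw [ofTree, inst, iha, ihb]

/-- The pattern for `CodeTree.vr`. -/
def vr (x : TreePattern) : TreePattern := node leaf x

/-- The pattern for `CodeTree.all`. -/
def all (x φ : TreePattern) : TreePattern := node (node leaf leaf) (node x φ)

/-- The pattern for `CodeTree.bin`. -/
def bin (k a b : TreePattern) : TreePattern := node (node (node leaf leaf) k) (node a b)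

/-- The pattern for `CodeTree.su`. -/
def su (t : TreePattern) : TreePattern := bin (ofTree (.num 0)) t leaf

/-- The pattern for `CodeTree.ad`. -/
def ad (s t : TreePattern) : TreePattern := bin (ofTree (.num 1)) s t

/-- The pattern for `CodeTree.mu`. -/
def mu (s t : TreePattern) : TreePattern := bin (ofTree (.num 2)) s t

/-- The pattern for `CodeTree.eq`. -/
def eq (s t : TreePattern) : TreePattern := bin (ofTree (.num 3)) s t

/-- The pattern for `CodeTree.imp`. -/
def imp (φ ψ : TreePattern) : TreePattern := bin (ofTree (.num 4)) φ ψ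

/-- The pattern for `CodeTree.prov`. -/
def prov (φ : TreePattern) : TreePattern := node leaf φ

/-- The pattern for `CodeTree.sub`. -/
def sub (x t e e' : TreePattern) : TreePattern :=
  node (node leaf leaf) (node (node x t) (node e e'))

/-- The pattern for `CodeTree.fresh`. -/
def fresh (y e : TreePattern) : TreePattern := node (node leaf (node leaf leaf)) (node y e)

section inst

variable (σ : ℕ → CodeTree) (p q r s : TreePattern)

@[simp] theorem inst_vr : (vr p).inst σ = .vr (p.inst σ) := rfl
@[simp] theorem inst_all : (all p q).inst σ = .all (p.inst σ) (q.inst σ) := rfl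
@[simp] theorem inst_bin : (bin p q r).inst σ = .bin (p.inst σ) (q.inst σ) (r.inst σ) := rfl
@[simp] theorem inst_su : (su p).inst σ = .su (p.inst σ) := rfl
@[simp] theorem inst_ad : (ad p q).inst σ = .ad (p.inst σ) (q.inst σ) := rfl
@[simp] theorem inst_mu : (mu p q).inst σ = .mu (p.inst σ) (q.inst σ) := rfl
@[simp] theorem inst_eq : (eq p q).inst σ = .eq (p.inst σ) (q.inst σ) := rfl
@[simp] theorem inst_imp : (imp p q).inst σ = .imp (p.inst σ) (q.inst σ) := rfl
@[simp] theorem inst_prov : (prov p).inst σ = .prov (p.inst σ) := rfl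
@[simp] theorem inst_sub :
    (sub p q r s).inst σ = .sub (p.inst σ) (q.inst σ) (r.inst σ) (s.inst σ) := rfl
@[simp] theorem inst_fresh : (fresh p q).inst σ = .fresh (p.inst σ) (q.inst σ) := rfl

end inst

end TreePattern

/-- The names of the rules of a calculus for provability, substitution and freshness. -/
inductive RuleName : Type
  | freshLeafNode | freshNodeLeaf | freshNodeLeft | freshNodeRight
  | freshLeaf | freshBin | freshAll
  | subVar | subFresh | subBin | subAll
  | succNeZero | succInj | addZero | addSucc | mulZero | mulSucc | induction
  | weaken | distrib | doubleNeg | specialize | eqRefl | eqSubst | mp | generalize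

open TreePattern in
/-- The rules. The first four say that different trees name different variables. The side conditions
in `subAll` exclude the capture of variables. The substitution judgements among the premises of the
rules for provability take the place of `instantiate` and `atSucc`. -/
def RuleName.rule : RuleName → HornRule
  | freshLeafNode => ⟨[], fresh leaf (vr (node (var 0) (var 1)))⟩
  | freshNodeLeaf => ⟨[], fresh (node (var 0) (var 1)) (vr leaf)⟩
  | freshNodeLeft => ⟨[fresh (var 0) (vr (var 1))],
      fresh (node (var 0) (var 2)) (vr (node (var 1) (var 3)))⟩
  | freshNodeRight => ⟨[fresh (var 0) (vr (var 1))],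
      fresh (node (var 2) (var 0)) (vr (node (var 3) (var 1)))⟩
  | freshLeaf => ⟨[], fresh (var 0) leaf⟩
  | freshBin => ⟨[fresh (var 0) (var 2), fresh (var 0) (var 3)],
      fresh (var 0) (bin (var 1) (var 2) (var 3))⟩
  | freshAll => ⟨[fresh (var 0) (var 2)], fresh (var 0) (all (var 1) (var 2))⟩
  | subVar => ⟨[], sub (var 0) (var 1) (vr (var 0)) (var 1)⟩
  | subFresh => ⟨[fresh (var 0) (var 2)], sub (var 0) (var 1) (var 2) (var 2)⟩
  | subBin => ⟨[sub (var 0) (var 1) (var 3) (var 4), sub (var 0) (var 1) (var 5) (var 6)],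
      sub (var 0) (var 1) (bin (var 2) (var 3) (var 5)) (bin (var 2) (var 4) (var 6))⟩
  | subAll => ⟨[fresh (var 2) (vr (var 0)), fresh (var 2) (var 1),
        sub (var 0) (var 1) (var 3) (var 4)],
      sub (var 0) (var 1) (all (var 2) (var 3)) (all (var 2) (var 4))⟩
  | succNeZero => ⟨[], prov (imp (eq (su (var 0)) leaf) leaf)⟩
  | succInj => ⟨[], prov (imp (eq (su (var 0)) (su (var 1))) (eq (var 0) (var 1)))⟩
  | addZero => ⟨[], prov (eq (ad (var 0) leaf) (var 0))⟩
  | addSucc => ⟨[], prov (eq (ad (var 0) (su (var 1))) (su (ad (var 0) (var 1))))⟩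
  | mulZero => ⟨[], prov (eq (mu (var 0) leaf) leaf)⟩
  | mulSucc => ⟨[], prov (eq (mu (var 0) (su (var 1))) (ad (mu (var 0) (var 1)) (var 0)))⟩
  | induction => ⟨[sub (var 0) leaf (var 1) (var 2), sub (var 0) (su (vr (var 0))) (var 1) (var 3)],
      prov (imp (var 2) (imp (all (var 0) (imp (var 1) (var 3))) (all (var 0) (var 1))))⟩
  | weaken => ⟨[], prov (imp (var 0) (imp (var 1) (var 0)))⟩
  | distrib => ⟨[], prov (imp (imp (var 0) (imp (var 1) (var 2)))
      (imp (imp (var 0) (var 1)) (imp (var 0) (var 2))))⟩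
  | doubleNeg => ⟨[], prov (imp (imp (imp (var 0) leaf) leaf) (var 0))⟩
  | specialize => ⟨[sub (var 0) (var 1) (var 2) (var 3)],
      prov (imp (all (var 0) (var 2)) (var 3))⟩
  | eqRefl => ⟨[], prov (eq (var 0) (var 0))⟩
  | eqSubst => ⟨[sub (var 0) (var 1) (var 3) (var 4), sub (var 0) (var 2) (var 3) (var 5)],
      prov (imp (eq (var 1) (var 2)) (imp (var 4) (var 5)))⟩
  | mp => ⟨[prov (imp (var 0) (var 1)), prov (var 0)], prov (var 1)⟩
  | generalize => ⟨[fresh (var 1) (var 2), fresh (var 1) (var 3),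
        sub (var 0) (vr (var 1)) (var 3) (var 4), prov (imp (var 2) (var 4))],
      prov (imp (var 2) (all (var 0) (var 3)))⟩

/-- The list of all names of rules. -/
def RuleName.list : List RuleName :=
  [freshLeafNode, freshNodeLeaf, freshNodeLeft, freshNodeRight, freshLeaf, freshBin, freshAll,
    subVar, subFresh, subBin, subAll, succNeZero, succInj, addZero, addSucc, mulZero, mulSucc,
    induction, weaken, distrib, doubleNeg, specialize, eqRefl, eqSubst, mp, generalize]

theorem RuleName.mem_list (r : RuleName) : r ∈ list := by
  cases r <;> simp [list]

/-- The list of all rules. -/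
def paRules : List HornRule := RuleName.list.map RuleName.rule

theorem RuleName.sound (r : RuleName) (σ : ℕ → CodeTree)
    (h : ∀ p ∈ r.rule.prems, (p.inst σ).Valid) : (r.rule.concl.inst σ).Valid := by
  cases r <;>
    simp only [rule, List.mem_cons, List.not_mem_nil, or_false, forall_eq_or_imp, forall_eq,
      TreePattern.inst_fresh, TreePattern.inst_vr, TreePattern.inst_sub, TreePattern.inst_prov,
      CodeTree.valid_fresh_vr] at h ⊢
  case freshLeafNode => exact fun h => by cases h
  case freshNodeLeaf => exact fun h => by cases h
  case freshNodeLeft => exact fun h' => h (CodeTree.node.inj h').1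
  case freshNodeRight => exact fun h' => h (CodeTree.node.inj h').2
  case freshLeaf => simp [TreePattern.inst]
  case freshBin =>
    rw [CodeTree.valid_fresh] at h ⊢
    intro v n
    simp [CodeTree.eval_bin, h.1 v n, CodeTree.valid_fresh.1 h.2 v n]
  case freshAll =>
    rw [CodeTree.valid_fresh] at h ⊢
    intro v n
    simp only [TreePattern.inst_all, CodeTree.eval_all]
    congr 1
    refine propext (forall_congr' fun m => ?_)
    by_cases hx : (TreePattern.var 1).inst σ = (TreePattern.var 0).inst σ
    · rw [hx, Function.update_idem]
    · rw [Function.update_comm (Ne.symm hx), h]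
  case subVar => simp
  case subFresh =>
    rw [CodeTree.valid_fresh] at h
    rw [CodeTree.valid_sub]
    exact fun v => (h v _).symm
  case subBin =>
    rw [CodeTree.valid_sub, CodeTree.valid_sub] at h
    rw [CodeTree.valid_sub]
    intro v
    simp [CodeTree.eval_bin, h.1 v, h.2 v]
  case subAll =>
    rw [CodeTree.valid_sub, CodeTree.valid_fresh] at h
    rw [CodeTree.valid_sub]
    intro v
    simp only [TreePattern.inst_all, CodeTree.eval_all]
    congr 1
    refine propext (forall_congr' fun m => ?_)
    rw [h.2.2, h.2.1, Function.update_comm (Ne.symm h.1)]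
  case succNeZero => simp [TreePattern.inst]
  case succInj => simp
  case addZero => simp [TreePattern.inst]
  case addSucc => simp [add_assoc]
  case mulZero => simp [TreePattern.inst]
  case mulSucc => simp [mul_add]
  case induction =>
    simp only [CodeTree.valid_sub, CodeTree.valid_prov, TreePattern.inst_imp,
      CodeTree.eval_imp_ne_zero, TreePattern.inst_all, CodeTree.eval_all_ne_zero] at h ⊢
    intro v h0 hs n
    induction n with
    | zero => rwa [h.1 v] at h0
    | succ n ih =>
      have := hs n ih
      rw [h.2] at this
      simpa using this
  case weaken =>
    simp only [CodeTree.valid_prov, TreePattern.inst_imp, CodeTree.eval_imp_ne_zero]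
    tauto
  case distrib =>
    simp only [CodeTree.valid_prov, TreePattern.inst_imp, CodeTree.eval_imp_ne_zero]
    tauto
  case doubleNeg =>
    simp only [CodeTree.valid_prov, TreePattern.inst_imp, CodeTree.eval_imp_ne_zero]
    intro v hv h0
    exact hv (fun h => absurd h0 h) rfl
  case specialize =>
    simp only [CodeTree.valid_sub, CodeTree.valid_prov, TreePattern.inst_imp,
      CodeTree.eval_imp_ne_zero, TreePattern.inst_all, CodeTree.eval_all_ne_zero] at h ⊢
    intro v hv
    rw [h]
    exact hv _
  case eqRefl => simp
  case eqSubst =>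
    simp only [CodeTree.valid_sub, CodeTree.valid_prov, TreePattern.inst_imp,
      CodeTree.eval_imp_ne_zero, TreePattern.inst_eq, CodeTree.eval_eq_ne_zero] at h ⊢
    intro v hv
    rw [h.1, h.2, hv]
    exact id
  case mp =>
    simp only [CodeTree.valid_prov, TreePattern.inst_imp, CodeTree.eval_imp_ne_zero] at h ⊢
    exact fun v => h.1 v (h.2 v)
  case generalize =>
    simp only [CodeTree.valid_sub, CodeTree.valid_prov, CodeTree.valid_fresh, TreePattern.inst_imp,
      CodeTree.eval_imp_ne_zero, TreePattern.inst_all, CodeTree.eval_all_ne_zero] at h ⊢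
    obtain ⟨hχ, hφ, hs, hp⟩ := h
    intro v hv n
    have := hp (Function.update v ((TreePattern.var 1).inst σ) n) (by rwa [hχ])
    rw [hs] at this
    simp only [CodeTree.eval_vr, Function.update_self] at this
    by_cases hx : (TreePattern.var 1).inst σ = (TreePattern.var 0).inst σ
    · rwa [hx, Function.update_idem] at this
    · rwa [Function.update_comm hx, hφ] at this

theorem valid_of_derives {t : CodeTree} (h : Derives paRules t) : t.Valid := by
  induction h with
  | @step r hr σ h ih =>
    obtain ⟨r, -, rfl⟩ := List.mem_map.1 hr
    exact r.sound σ ih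

/-- An instance of a rule, with the values of the variables of the rule given as a list. -/
theorem derives_rule (r : RuleName) (l : List CodeTree)
    (h : ∀ p ∈ r.rule.prems, Derives paRules (p.inst (listAssign l))) :
    Derives paRules (r.rule.concl.inst (listAssign l)) :=
  .step (List.mem_map_of_mem r.mem_list) _ h

/-! ### Coding formulas -/

/-- The number of nested quantifiers of a formula. -/
def height {α : Type} : ∀ {n : ℕ}, arith.BoundedFormula α n → ℕ
  | _, .falsum => 0
  | _, .equal _ _ => 0
  | _, .rel _ _ => 0
  | _, .imp φ ψ => max (height φ) (height ψ)
  | _, .all φ => height φ + 1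

/-- The name of a variable that is bound by a quantifier whose scope has height `j`. -/
def boundName (j : ℕ) : CodeTree := .node (.node .leaf .leaf) (.num j)

/-- The name of the free variable `fv i`. -/
def freeName (i : ℕ) : CodeTree := .node .leaf (.num i)

theorem boundName_injective : Function.Injective boundName := fun _ _ h =>
  CodeTree.num_injective (CodeTree.node.inj h).2

theorem freeName_injective : Function.Injective freeName := fun _ _ h =>
  CodeTree.num_injective (CodeTree.node.inj h).2

theorem boundName_ne_freeName (i j : ℕ) : boundName j ≠ freeName i := by
  simp [boundName, freeName]

/-- Trees as a structure for the language of arithmetic: the function symbols build the codes of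
terms, so that the realization of a term is its code. -/
instance codeStructure : arith.Structure CodeTree where
  funMap := fun {_} f =>
    match f with
    | ArithFunc.zero => fun _ => .leaf
    | ArithFunc.succ => fun v => .su (v 0)
    | ArithFunc.add => fun v => .ad (v 0) (v 1)
    | ArithFunc.mul => fun v => .mu (v 0) (v 1)
  RelMap := fun {_} r => r.elim

/-- The code of a formula, with the expressions `v i` and `xs i` inserted for its variables. The
name of a bound variable is determined by the height of the scope of its quantifier. Therefore it
differs from the names that are bound inside the scope, and it does not change when the formula is
relabelled or when terms are substituted into it. -/
def code {α : Type} : ∀ {n : ℕ}, arith.BoundedFormula α n → (α → CodeTree) →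
    (Fin n → CodeTree) → CodeTree
  | _, .falsum, _, _ => .leaf
  | _, .equal s t, v, xs => .eq (s.realize (Sum.elim v xs)) (t.realize (Sum.elim v xs))
  | _, .rel R _, _, _ => Empty.elim R
  | _, .imp φ ψ, v, xs => .imp (code φ v xs) (code ψ v xs)
  | _, .all φ, v, xs => .all (boundName (height φ))
      (code φ v (Fin.snoc xs (.vr (boundName (height φ)))))

section relabelling

variable {α β : Type}

@[simp] theorem height_castLE {m n : ℕ} (h : m ≤ n) (φ : arith.BoundedFormula α m) :
    height (φ.castLE h) = height φ := by
  induction φ generalizing n with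
  | falsum => rfl
  | equal => rfl
  | rel => rfl
  | imp _ _ ih1 ih2 => simp [height, ih1, ih2]
  | all _ ih => simp [height, ih]

theorem height_mapTermRel {g : ℕ → ℕ}
    {ft : ∀ n, arith.Term (α ⊕ (Fin n)) → arith.Term (β ⊕ (Fin (g n)))}
    {fr : ∀ n, arith.Relations n → arith.Relations n}
    {h : ∀ n, arith.BoundedFormula β (g (n + 1)) → arith.BoundedFormula β (g n + 1)}
    (hh : ∀ n φ, height (h n φ) = height φ) {n : ℕ} (φ : arith.BoundedFormula α n) :
    height (φ.mapTermRel ft fr h) = height φ := by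
  induction φ with
  | falsum => rfl
  | equal => rfl
  | rel => rfl
  | imp _ _ ih1 ih2 => simp [height, BoundedFormula.mapTermRel, ih1, ih2]
  | all _ ih => simp [height, BoundedFormula.mapTermRel, ih, hh]

@[simp] theorem height_relabel {m n : ℕ} (g : α → β ⊕ (Fin m)) (φ : arith.BoundedFormula α n) :
    height (φ.relabel g) = height φ :=
  height_mapTermRel (fun _ _ => height_castLE _ _) φ

@[simp] theorem height_subst {n : ℕ} (φ : arith.BoundedFormula α n) (f : α → arith.Term β) :
    height (φ.subst f) = height φ :=
  height_mapTermRel (g := fun n => n) (h := fun _ => id) (fun _ _ => rfl) φ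

@[simp] theorem height_toFormula {n : ℕ} (φ : arith.BoundedFormula α n) :
    height φ.toFormula = height φ := by
  induction φ with
  | falsum => rfl
  | equal => rfl
  | rel => rfl
  | imp _ _ ih1 ih2 => simp [height, BoundedFormula.toFormula, ih1, ih2]
  | all _ ih => rw [BoundedFormula.toFormula, height, height_relabel, ih, height]

theorem code_subst {n : ℕ} (φ : arith.BoundedFormula α n) (f : α → arith.Term β)
    (v : β → CodeTree) (xs : Fin n → CodeTree) :
    code (φ.subst f) v xs = code φ (fun a => (f a).realize v) xs := by
  have ht (n : ℕ) (t : arith.Term (α ⊕ Fin n)) (xs : Fin n → CodeTree) :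
      (t.subst (Sum.elim (Term.relabel Sum.inl ∘ f) (Term.var ∘ Sum.inr))).realize (Sum.elim v xs) =
        t.realize (Sum.elim (fun a => (f a).realize v) xs) := by
    rw [Term.realize_subst]
    congr 1
    ext a
    cases a <;> simp
  induction φ with
  | falsum => rfl
  | equal => simp only [BoundedFormula.subst, BoundedFormula.mapTermRel, code, ht]
  | rel R => exact Empty.elim R
  | imp φ ψ ih1 ih2 => exact congrArg₂ CodeTree.imp (ih1 xs) (ih2 xs)
  | all φ ih =>
    change CodeTree.all (boundName (height (φ.subst f)))
      (code (φ.subst f) v (Fin.snoc xs (.vr (boundName (height (φ.subst f)))))) = _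
    rw [ih, height_subst, code]

theorem code_relabel {m n : ℕ} (φ : arith.BoundedFormula α n) (g : α → β ⊕ Fin m)
    (v : β → CodeTree) (xs : Fin (m + n) → CodeTree) :
    code (φ.relabel g) v xs =
      code φ (Sum.elim v (xs ∘ Fin.castAdd n) ∘ g) (xs ∘ Fin.natAdd m) := by
  induction φ with
  | falsum => rfl
  | equal => simp [BoundedFormula.relabel, BoundedFormula.mapTermRel, code]
  | rel R => exact Empty.elim R
  | imp φ ψ ih1 ih2 => exact congrArg₂ CodeTree.imp (ih1 xs) (ih2 xs)
  | all φ ih =>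
    rw [BoundedFormula.relabel_all, code, code, ih, height_relabel]
    simp

theorem code_toFormula {n : ℕ} (φ : arith.BoundedFormula α n) (v : α ⊕ Fin n → CodeTree)
    (xs : Fin 0 → CodeTree) :
    code φ.toFormula v xs = code φ (v ∘ Sum.inl) (v ∘ Sum.inr) := by
  induction φ generalizing xs with
  | falsum => rfl
  | equal s t =>
    simp [BoundedFormula.toFormula, Term.equal, Term.bdEqual, code]
  | rel R => exact Empty.elim R
  | imp φ ψ ih1 ih2 => exact congrArg₂ CodeTree.imp (ih1 v xs) (ih2 v xs)
  | @all n φ ih =>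
    rw [BoundedFormula.toFormula, code, code, height_relabel, height_toFormula, code_relabel, ih]
    congr 2
    funext x
    refine Fin.lastCases ?_ (fun i => ?_) x
    · simp [Fin.snoc]
    · simp only [Function.comp_apply, Fin.castSucc, Sum.elim_inr,
        finSumFinEquiv_symm_apply_castAdd, Sum.map_inl, Sum.elim_inl]
      rw [← Fin.castSucc]
      simp

end relabelling

theorem code_instantiate (φ : arith.BoundedFormula ℕ 1) (t : arith.Term ℕ) (v : ℕ → CodeTree)
    (xs : Fin 0 → CodeTree) :
    code (instantiate φ t) v xs = code φ v fun _ => t.realize v := by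
  rw [instantiate, code_subst, code_toFormula]
  rfl

theorem code_atSucc (φ : arith.BoundedFormula ℕ 1) (v : ℕ → CodeTree) (xs : Fin 1 → CodeTree) :
    code (atSucc φ) v xs = code φ v fun i => .su (xs i) := by
  rw [atSucc]
  refine (code_relabel (m := 1) (n := 0) _ id v xs).trans ?_
  rw [code_subst, code_toFormula]
  rfl

theorem height_atSucc (φ : arith.BoundedFormula ℕ 1) : height (atSucc φ) = height φ := by
  rw [atSucc]
  refine (height_relabel (m := 1) (n := 0) id _).trans ?_
  rw [height_subst, height_toFormula]

/-! ### Simulation of Peano Arithmetic by the rules -/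

/-- Derivability of judgements. -/
abbrev Der : CodeTree → Prop := Derives paRules

/-- The rules derive that distinct names are distinct. -/
theorem der_fresh_vr {x y : CodeTree} (h : x ≠ y) : Der (.fresh x (.vr y)) := by
  induction x generalizing y with
  | leaf =>
    cases y with
    | leaf => exact absurd rfl h
    | node c d => exact derives_rule .freshLeafNode [c, d] (by simp [RuleName.rule])
  | node a b iha ihb =>
    cases y with
    | leaf => exact derives_rule .freshNodeLeaf [a, b] (by simp [RuleName.rule])
    | node c d =>
      by_cases hac : a = c
      · have hbd : b ≠ d := fun hbd => h (by rw [hac, hbd])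
        exact derives_rule .freshNodeRight [b, d, a, c]
          (by simpa [RuleName.rule] using! ihb hbd)
      · exact derives_rule .freshNodeLeft [a, c, b, d]
          (by simpa [RuleName.rule] using! iha hac)

theorem der_fresh_leaf (y : CodeTree) : Der (.fresh y .leaf) :=
  derives_rule .freshLeaf [y] (by simp [RuleName.rule])

theorem der_fresh_bin {y a b : CodeTree} (k : CodeTree) (ha : Der (.fresh y a))
    (hb : Der (.fresh y b)) : Der (.fresh y (.bin k a b)) :=
  derives_rule .freshBin [y, k, a, b] (by simpa [RuleName.rule] using! ⟨ha, hb⟩)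

theorem der_fresh_all {y φ : CodeTree} (x : CodeTree) (h : Der (.fresh y φ)) :
    Der (.fresh y (.all x φ)) :=
  derives_rule .freshAll [y, x, φ] (by simpa [RuleName.rule] using! h)

theorem der_sub_vr (x t : CodeTree) : Der (.sub x t (.vr x) t) :=
  derives_rule .subVar [x, t] (by simp [RuleName.rule])

theorem der_sub_of_fresh {x e : CodeTree} (t : CodeTree) (h : Der (.fresh x e)) :
    Der (.sub x t e e) :=
  derives_rule .subFresh [x, t, e] (by simpa [RuleName.rule] using! h)

theorem der_sub_bin {x t a a' b b' : CodeTree} (k : CodeTree) (ha : Der (.sub x t a a'))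
    (hb : Der (.sub x t b b')) : Der (.sub x t (.bin k a b) (.bin k a' b')) :=
  derives_rule .subBin [x, t, k, a, a', b, b'] (by simpa [RuleName.rule] using! ⟨ha, hb⟩)

theorem der_sub_all {x t y φ ψ : CodeTree} (hx : y ≠ x) (ht : Der (.fresh y t))
    (h : Der (.sub x t φ ψ)) : Der (.sub x t (.all y φ) (.all y ψ)) :=
  derives_rule .subAll [x, t, y, φ, ψ]
    (by simpa [RuleName.rule] using! ⟨der_fresh_vr hx, ht, h⟩)

theorem der_fresh_term {α : Type} {y : CodeTree} (t : arith.Term α) {v : α → CodeTree}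
    (hv : ∀ i, Der (.fresh y (v i))) : Der (.fresh y (t.realize v)) := by
  induction t with
  | var i => exact hv i
  | func f ts ih =>
    cases f with
    | zero => exact der_fresh_leaf y
    | succ => exact der_fresh_bin _ (ih 0) (der_fresh_leaf y)
    | add => exact der_fresh_bin _ (ih 0) (ih 1)
    | mul => exact der_fresh_bin _ (ih 0) (ih 1)

theorem der_fresh_term_left {α β : Type} [DecidableEq α] {y : CodeTree} (t : arith.Term (α ⊕ β))
    {v : α → CodeTree} {w : β → CodeTree} (hv : ∀ i ∈ t.varFinsetLeft, Der (.fresh y (v i)))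
    (hw : ∀ i, Der (.fresh y (w i))) : Der (.fresh y (t.realize (Sum.elim v w))) := by
  induction t with
  | var i =>
    cases i with
    | inl i => exact hv i (by simp [Term.varFinsetLeft])
    | inr i => exact hw i
  | func f ts ih =>
    have ih' := fun i => ih i fun j hj => hv j (by
      simp only [Term.varFinsetLeft, Finset.mem_biUnion]
      exact ⟨i, Finset.mem_univ _, hj⟩)
    cases f with
    | zero => exact der_fresh_leaf y
    | succ => exact der_fresh_bin _ (ih' 0) (der_fresh_leaf y)
    | add => exact der_fresh_bin _ (ih' 0) (ih' 1)
    | mul => exact der_fresh_bin _ (ih' 0) (ih' 1)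

theorem der_fresh_code {y : CodeTree} (hy : ∀ j, y ≠ boundName j) {n : ℕ}
    (φ : arith.BoundedFormula ℕ n) {v : ℕ → CodeTree} {xs : Fin n → CodeTree}
    (hv : ∀ i ∈ φ.freeVarFinset, Der (.fresh y (v i))) (hxs : ∀ i, Der (.fresh y (xs i))) :
    Der (.fresh y (code φ v xs)) := by
  induction φ with
  | falsum => exact der_fresh_leaf y
  | equal s t =>
    exact der_fresh_bin _
      (der_fresh_term_left s (fun i hi => hv i (by simp [hi])) hxs)
      (der_fresh_term_left t (fun i hi => hv i (by simp [hi])) hxs)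
  | rel R => exact Empty.elim R
  | imp φ ψ ih1 ih2 =>
    exact der_fresh_bin _ (ih1 (fun i hi => hv i (by simp [hi])) hxs)
      (ih2 (fun i hi => hv i (by simp [hi])) hxs)
  | all φ ih =>
    refine der_fresh_all _ (ih hv fun i => ?_)
    refine Fin.lastCases ?_ (fun i => ?_) i
    · simpa using der_fresh_vr (hy _)
    · simpa using hxs i

theorem der_sub_term {α : Type} {x s : CodeTree} (t : arith.Term α) {v v' : α → CodeTree}
    (hv : ∀ i, Der (.sub x s (v i) (v' i))) : Der (.sub x s (t.realize v) (t.realize v')) := by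
  induction t with
  | var i => exact hv i
  | func f ts ih =>
    cases f with
    | zero => exact der_sub_of_fresh _ (der_fresh_leaf x)
    | succ => exact der_sub_bin _ (ih 0) (der_sub_of_fresh _ (der_fresh_leaf x))
    | add => exact der_sub_bin _ (ih 0) (ih 1)
    | mul => exact der_sub_bin _ (ih 0) (ih 1)

/-- Substitution into the code of a formula amounts to changing the expressions that are inserted
for the variables of the formula. -/
theorem der_sub_code {α : Type} {x s : CodeTree} {n : ℕ} (φ : arith.BoundedFormula α n)
    {v v' : α → CodeTree} {xs xs' : Fin n → CodeTree} (hx : ∀ j < height φ, boundName j ≠ x)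
    (hs : ∀ j < height φ, Der (.fresh (boundName j) s))
    (hv : ∀ i, Der (.sub x s (v i) (v' i))) (hxs : ∀ i, Der (.sub x s (xs i) (xs' i))) :
    Der (.sub x s (code φ v xs) (code φ v' xs')) := by
  induction φ with
  | falsum => exact der_sub_of_fresh _ (der_fresh_leaf x)
  | equal t u =>
    refine der_sub_bin _ (der_sub_term t ?_) (der_sub_term u ?_)
    all_goals
      rintro (i | i)
      · exact hv i
      · exact hxs i
  | rel R => exact Empty.elim R
  | imp φ ψ ih1 ih2 =>
    exact der_sub_bin _
      (ih1 (fun j hj => hx j (lt_max_of_lt_left hj)) (fun j hj => hs j (lt_max_of_lt_left hj)) hxs)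
      (ih2 (fun j hj => hx j (lt_max_of_lt_right hj)) (fun j hj => hs j (lt_max_of_lt_right hj))
        hxs)
  | all φ ih =>
    refine der_sub_all (hx _ (Nat.lt_succ_self _)) (hs _ (Nat.lt_succ_self _))
      (ih (fun j hj => hx j (Nat.lt_succ_of_lt hj)) (fun j hj => hs j (Nat.lt_succ_of_lt hj)) ?_)
    intro i
    refine Fin.lastCases ?_ (fun i => ?_) i
    · simpa using der_sub_of_fresh _ (der_fresh_vr (hx _ (Nat.lt_succ_self _)).symm)
    · simpa using hxs i

/-- The code of a formula of the calculus, in which `fv i` is coded by the variable named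
`freeName i`. -/
def formulaCode (φ : arith.Formula ℕ) : CodeTree :=
  code φ (fun i => .vr (freeName i)) default

/-- The code of a term of the calculus. -/
def termCode (t : arith.Term ℕ) : CodeTree := t.realize fun i => .vr (freeName i)

/-- The code of a formula with a distinguished variable, with an expression inserted for that
variable. -/
def bodyCode (φ : arith.BoundedFormula ℕ 1) (e : CodeTree) : CodeTree :=
  code φ (fun i => .vr (freeName i)) fun _ => e

theorem formulaCode_instantiate (φ : arith.BoundedFormula ℕ 1) (t : arith.Term ℕ) :
    formulaCode (instantiate φ t) = bodyCode φ (termCode t) :=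
  code_instantiate φ t _ _

theorem formulaCode_all (φ : arith.BoundedFormula ℕ 1) : formulaCode φ.all =
    .all (boundName (height φ)) (bodyCode φ (.vr (boundName (height φ)))) := by
  rw [formulaCode, code, bodyCode]
  congr 2

theorem der_fresh_boundName_termCode (j : ℕ) (t : arith.Term ℕ) :
    Der (.fresh (boundName j) (termCode t)) :=
  der_fresh_term t fun i => der_fresh_vr (boundName_ne_freeName i j)

theorem der_sub_bodyCode (φ : arith.BoundedFormula ℕ 1) {e : CodeTree}
    (he : ∀ j < height φ, Der (.fresh (boundName j) e)) :
    Der (.sub (boundName (height φ)) e (bodyCode φ (.vr (boundName (height φ))))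
      (bodyCode φ e)) :=
  der_sub_code φ (fun _ hj h => hj.ne (boundName_injective h)) he
    (fun i => der_sub_of_fresh _ (der_fresh_vr (boundName_ne_freeName i _)))
    (fun _ => der_sub_vr _ _)

theorem der_of_postulate {φ : arith.Formula ℕ} (h : PeanoPostulate φ) :
    Der (.prov (formulaCode φ)) := by
  cases h with
  | succ_ne_zero => exact derives_rule .succNeZero [termCode (fv 0)] (by simp [RuleName.rule])
  | succ_inj =>
    exact derives_rule .succInj [termCode (fv 0), termCode (fv 1)] (by simp [RuleName.rule])
  | add_zero => exact derives_rule .addZero [termCode (fv 0)] (by simp [RuleName.rule])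
  | add_succ =>
    exact derives_rule .addSucc [termCode (fv 0), termCode (fv 1)] (by simp [RuleName.rule])
  | mul_zero => exact derives_rule .mulZero [termCode (fv 0)] (by simp [RuleName.rule])
  | mul_succ =>
    exact derives_rule .mulSucc [termCode (fv 0), termCode (fv 1)] (by simp [RuleName.rule])
  | induction φ =>
    have h0 := der_sub_bodyCode φ (e := .leaf) fun j _ => der_fresh_leaf _
    have hS := der_sub_bodyCode φ (e := .su (.vr (boundName (height φ)))) fun j hj =>
      der_fresh_bin _ (der_fresh_vr fun h => hj.ne (boundName_injective h)) (der_fresh_leaf _)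
    have key : formulaCode
        ((instantiate φ tZero).imp (((φ.imp (atSucc φ)).all).imp φ.all)) =
        .imp (bodyCode φ .leaf) (.imp (.all (boundName (height φ))
          (.imp (bodyCode φ (.vr (boundName (height φ))))
            (bodyCode φ (.su (.vr (boundName (height φ)))))))
          (.all (boundName (height φ)) (bodyCode φ (.vr (boundName (height φ)))))) := by
      refine congrArg₂ CodeTree.imp (formulaCode_instantiate φ tZero)
        (congrArg₂ CodeTree.imp ?_ (formulaCode_all φ))
      have hh : height (φ.imp (atSucc φ)) = height φ := by simp [height, height_atSucc]
      refine (formulaCode_all _).trans ?_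
      rw [hh]
      exact congrArg (CodeTree.all _ <| CodeTree.imp _ ·) (code_atSucc φ _ _)
    rw [key]
    exact derives_rule .induction [boundName (height φ), bodyCode φ (.vr (boundName (height φ))),
      bodyCode φ .leaf, bodyCode φ (.su (.vr (boundName (height φ))))]
      (by simpa [RuleName.rule] using! ⟨h0, hS⟩)

/-- The rules simulate the calculus of Peano Arithmetic. -/
theorem der_of_paDerivable {φ : arith.Formula ℕ} (h : PADerivable φ) :
    Der (.prov (formulaCode φ)) := by
  induction h with
  | postulate h => exact der_of_postulate h
  | weaken φ ψ =>
    exact derives_rule .weaken [formulaCode φ, formulaCode ψ] (by simp [RuleName.rule])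
  | distrib φ ψ χ =>
    exact derives_rule .distrib [formulaCode φ, formulaCode ψ, formulaCode χ]
      (by simp [RuleName.rule])
  | double_neg φ => exact derives_rule .doubleNeg [formulaCode φ] (by simp [RuleName.rule])
  | specialize φ t =>
    have h := der_sub_bodyCode φ fun j _ => der_fresh_boundName_termCode j t
    have key : formulaCode (φ.all.imp (instantiate φ t)) = .imp (.all (boundName (height φ))
        (bodyCode φ (.vr (boundName (height φ))))) (bodyCode φ (termCode t)) :=
      congrArg₂ CodeTree.imp (formulaCode_all φ) (formulaCode_instantiate φ t)
    rw [key]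
    exact derives_rule .specialize [boundName (height φ), termCode t,
      bodyCode φ (.vr (boundName (height φ))), bodyCode φ (termCode t)]
      (by simpa [RuleName.rule] using! h)
  | eq_refl t =>
    have key : formulaCode (t.equal t) = .eq (termCode t) (termCode t) := by
      simp [formulaCode, Term.equal, Term.bdEqual, code, termCode]
    rw [key]
    exact derives_rule .eqRefl [termCode t] (by simp [RuleName.rule])
  | eq_subst φ s t =>
    have hs := der_sub_bodyCode φ fun j _ => der_fresh_boundName_termCode j s
    have ht := der_sub_bodyCode φ fun j _ => der_fresh_boundName_termCode j t
    have heq : formulaCode (s.equal t) = .eq (termCode s) (termCode t) := by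
      simp [formulaCode, Term.equal, Term.bdEqual, code, termCode]
    have key : formulaCode ((s.equal t).imp ((instantiate φ s).imp (instantiate φ t))) =
        .imp (.eq (termCode s) (termCode t))
          (.imp (bodyCode φ (termCode s)) (bodyCode φ (termCode t))) :=
      congrArg₂ CodeTree.imp heq (congrArg₂ CodeTree.imp (formulaCode_instantiate φ s)
        (formulaCode_instantiate φ t))
    rw [key]
    exact derives_rule .eqSubst [boundName (height φ), termCode s, termCode t,
      bodyCode φ (.vr (boundName (height φ))), bodyCode φ (termCode s), bodyCode φ (termCode t)]
      (by simpa [RuleName.rule] using! ⟨hs, ht⟩)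
  | @mp φ ψ _ _ ih1 ih2 =>
    exact derives_rule .mp [formulaCode φ, formulaCode ψ]
      (by simpa [RuleName.rule] using! ⟨ih1, ih2⟩)
  | @generalize χ φ i hχ hφ _ ih =>
    have hs := der_sub_bodyCode φ fun j _ => der_fresh_boundName_termCode j (fv i)
    have hi (j : ℕ) : freeName i ≠ boundName j := (boundName_ne_freeName i j).symm
    have hne {S : Finset ℕ} (hS : i ∉ S) (j : ℕ) (hj : j ∈ S) :
        Der (.fresh (freeName i) (.vr (freeName j))) :=
      der_fresh_vr fun h => hS (freeName_injective h ▸ hj)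
    have h1 : Der (.fresh (freeName i) (formulaCode χ)) :=
      der_fresh_code hi χ (hne hχ) fun j => j.elim0
    have h2 : Der (.fresh (freeName i) (bodyCode φ (.vr (boundName (height φ))))) :=
      der_fresh_code hi φ (hne hφ) fun _ => der_fresh_vr (hi _)
    have h3 : Der (.prov (.imp (formulaCode χ) (bodyCode φ (termCode (fv i))))) := by
      rw [← formulaCode_instantiate]
      exact ih
    have key : formulaCode (χ.imp φ.all) = .imp (formulaCode χ) (.all (boundName (height φ))
        (bodyCode φ (.vr (boundName (height φ))))) :=
      congrArg (CodeTree.imp _) (formulaCode_all φ)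
    rw [key]
    exact derives_rule .generalize [boundName (height φ), freeName i, formulaCode χ,
      bodyCode φ (.vr (boundName (height φ))), bodyCode φ (termCode (fv i))]
      (by simpa [RuleName.rule] using! ⟨h1, h2, hs, h3⟩)

/-! ### Soundness, and an enumeration of the provable instances of a formula -/

theorem eval_term {α : Type} (t : arith.Term α) (v : α → CodeTree) (e : CodeTree → ℕ) :
    (t.realize v).eval e = t.realize fun i => (v i).eval e := by
  induction t with
  | var i => rfl
  | func f ts ih =>
    cases f with
    | zero => rfl
    | succ => exact (CodeTree.eval_su _ _).trans (congrArg (· + 1) (ih 0))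
    | add => exact (CodeTree.eval_ad _ _ _).trans (congrArg₂ (· + ·) (ih 0) (ih 1))
    | mul => exact (CodeTree.eval_mu _ _ _).trans (congrArg₂ (· * ·) (ih 0) (ih 1))

/-- The code of a formula has the meaning of the formula in the standard model, provided that no
variable of the inserted expressions is captured. -/
theorem eval_code_ne_zero {α : Type} {n : ℕ} (φ : arith.BoundedFormula α n) {v : α → CodeTree}
    {xs : Fin n → CodeTree}
    (hv : ∀ j < height φ, ∀ i, (CodeTree.fresh (boundName j) (v i)).Valid)
    (hxs : ∀ j < height φ, ∀ i, (CodeTree.fresh (boundName j) (xs i)).Valid) (e : CodeTree → ℕ) :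
    (code φ v xs).eval e ≠ 0 ↔ φ.Realize (fun i => (v i).eval e) fun i => (xs i).eval e := by
  induction φ generalizing e with
  | falsum => simp [code, BoundedFormula.Realize]
  | @equal n s t =>
    have h : (fun i => (Sum.elim v xs i).eval e) =
        Sum.elim (fun i => (v i).eval e) fun i => (xs i).eval e := by
      funext i; cases i <;> rfl
    simp only [code, CodeTree.eval_eq_ne_zero, BoundedFormula.Realize, eval_term, h]
  | rel R => exact Empty.elim R
  | imp φ ψ ih1 ih2 =>
    simp only [code, CodeTree.eval_imp_ne_zero, BoundedFormula.Realize]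
    rw [ih1 (fun j hj => hv j (lt_max_of_lt_left hj)) (fun j hj => hxs j (lt_max_of_lt_left hj)),
      ih2 (fun j hj => hv j (lt_max_of_lt_right hj)) (fun j hj => hxs j (lt_max_of_lt_right hj))]
  | @all n φ ih =>
    simp only [code, CodeTree.eval_all_ne_zero, BoundedFormula.Realize]
    refine forall_congr' fun a => ?_
    rw [ih (fun j hj => hv j (Nat.lt_succ_of_lt hj))]
    · have h1 (i : α) := CodeTree.valid_fresh.1 (hv (height φ) (Nat.lt_succ_self _) i) e a
      have h2 (i : Fin n) := CodeTree.valid_fresh.1 (hxs (height φ) (Nat.lt_succ_self _) i) e a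
      simp only [h1]
      refine iff_of_eq (congrArg _ (funext fun i => ?_))
      refine Fin.lastCases ?_ (fun i => ?_) i
      · simp
      · simpa using h2 i
    · intro j hj i
      refine Fin.lastCases ?_ (fun i => ?_) i
      · rw [Fin.snoc_last]
        exact CodeTree.valid_fresh_vr.2 fun h => hj.ne (boundName_injective h)
      · rw [Fin.snoc_castSucc]
        exact hxs j (Nat.lt_succ_of_lt hj) i

theorem realize_numeral (n : ℕ) {α : Type} (v : α → ℕ) :
    (numeral n : arith.Term α).realize v = n := by
  induction n with
  | zero => rfl
  | succ n ih => exact congrArg (· + 1) ih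

/-- The code of the `n`-th numeral. -/
def numeralCode (n : ℕ) : CodeTree := (numeral n : arith.Term Empty).realize Empty.elim

/-- The code of the sentence that says `n` satisfies `P`. -/
def instanceCode (P : arith.Formula (Fin 1)) (n : ℕ) : CodeTree :=
  code P (fun _ => numeralCode n) default

theorem primrec_bin {f g : ℕ → CodeTree} (k : CodeTree) (hf : Primrec f) (hg : Primrec g) :
    Primrec fun n => CodeTree.bin k (f n) (g n) :=
  CodeTree.primrec_node.comp (Primrec.const _) (CodeTree.primrec_node.comp hf hg)

theorem primrec_numeralCode : Primrec numeralCode := by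
  have : Primrec₂ fun (_ : ℕ) (t : CodeTree) => CodeTree.su t :=
    CodeTree.primrec_node.comp (Primrec.const _)
      (CodeTree.primrec_node.comp Primrec.snd (Primrec.const _))
  refine (Primrec.nat_rec₁ .leaf this).of_eq fun n => ?_
  induction n with
  | zero => rfl
  | succ n ih => exact congrArg CodeTree.su ih

theorem primrec_term {α : Type} (t : arith.Term α) {v : ℕ → α → CodeTree}
    (hv : ∀ i, Primrec fun n => v n i) : Primrec fun n => t.realize (v n) := by
  induction t with
  | var i => exact hv i
  | func f ts ih =>
    cases f with
    | zero => exact Primrec.const _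
    | succ => exact primrec_bin _ (ih 0) (Primrec.const _)
    | add => exact primrec_bin _ (ih 0) (ih 1)
    | mul => exact primrec_bin _ (ih 0) (ih 1)

theorem primrec_code {α : Type} {m : ℕ} (φ : arith.BoundedFormula α m) {v : ℕ → α → CodeTree}
    {xs : ℕ → Fin m → CodeTree} (hv : ∀ i, Primrec fun n => v n i)
    (hxs : ∀ i, Primrec fun n => xs n i) : Primrec fun n => code φ (v n) (xs n) := by
  induction φ with
  | falsum => exact Primrec.const _
  | equal s t =>
    refine primrec_bin _ (primrec_term s ?_) (primrec_term t ?_)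
    all_goals
      rintro (i | i)
      · exact hv i
      · exact hxs i
  | rel R => exact Empty.elim R
  | imp φ ψ ih1 ih2 => exact primrec_bin _ (ih1 hxs) (ih2 hxs)
  | all φ ih =>
    refine CodeTree.primrec_node.comp (Primrec.const _)
      (CodeTree.primrec_node.comp (Primrec.const _) (ih fun i => ?_))
    refine Fin.lastCases ?_ (fun i => ?_) i
    · simpa using Primrec.const _
    · simpa using hxs i

theorem primrec_instanceCode (P : arith.Formula (Fin 1)) : Primrec (instanceCode P) :=
  primrec_code P (fun _ => primrec_numeralCode) fun i => i.elim0

theorem realize_numeral_eq_numeralCode (n : ℕ) {α : Type} (v : α → CodeTree) :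
    (numeral n : arith.Term α).realize v = numeralCode n := by
  induction n with
  | zero => rfl
  | succ n ih => exact congrArg CodeTree.su ih

theorem der_of_paProves {P : arith.Formula (Fin 1)} {n : ℕ} (h : PAProves (instanceAt P n)) :
    Der (.prov (instanceCode P n)) := by
  have := der_of_paDerivable h
  have key : formulaCode (Formula.relabel Empty.elim (instanceAt P n)) = instanceCode P n := by
    refine (code_relabel (m := 0) (n := 0) (instanceAt P n) _ _ _).trans ?_
    refine (code_subst P _ _ _).trans ?_
    simp only [realize_numeral_eq_numeralCode]
    exact congrArg _ (Subsingleton.elim _ _)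
  rwa [key] at this

theorem models_instanceAt {P : arith.Formula (Fin 1)} {n : ℕ} :
    ℕ ⊨ instanceAt P n ↔ P.Realize fun _ => n := by
  refine BoundedFormula.realize_subst.trans ?_
  simp only [realize_numeral]
  exact Iff.rfl

/-- The sentences that the rules prove are true, because the rules preserve the semantic content of
judgements. -/
theorem models_of_der {P : arith.Formula (Fin 1)} {n : ℕ} (h : Der (.prov (instanceCode P n))) :
    ℕ ⊨ instanceAt P n := by
  have h := CodeTree.valid_prov.1 (valid_of_derives h) fun _ => 0
  have hn (e : CodeTree → ℕ) : (numeralCode n).eval e = n :=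
    (eval_term _ _ e).trans (realize_numeral n _)
  rw [instanceCode, eval_code_ne_zero] at h
  · rw [models_instanceAt]
    simp only [hn] at h
    exact (congrArg (BoundedFormula.Realize P _) (Subsingleton.elim _ _)).mp h
  · intro j _ i
    rw [CodeTree.valid_fresh]
    intro v m
    rw [hn, hn]
  · exact fun _ _ i => i.elim0

/-- The instances of a formula that the rules derive form a recursively enumerable set between the
set of the instances provable in Peano Arithmetic and the set of the true instances. -/
theorem exists_rePred_between (P : arith.Formula (Fin 1)) : ∃ p : ℕ → Prop, REPred p ∧
    (∀ n, PAProves (instanceAt P n) → p n) ∧ ∀ n, p n → ℕ ⊨ instanceAt P n :=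
  ⟨fun n => Der (.prov (instanceCode P n)),
    rePred_derives _ (CodeTree.primrec_node.comp (Primrec.const _) (primrec_instanceCode P)),
    fun _ => der_of_paProves, fun _ => models_of_der⟩

/-! ### Arithmetical definability -/

/-- A predicate of assignments of numbers to variables is arithmetical if a formula defines it in
the standard model. -/
def Arithmetical {α : Type} (p : (α → ℕ) → Prop) : Prop :=
  ∃ φ : arith.Formula α, ∀ v, φ.Realize v ↔ p v

/-- A function of assignments of numbers to variables is given by a term. -/
def IsTermFun {α : Type} (f : (α → ℕ) → ℕ) : Prop :=
  ∃ t : arith.Term α, ∀ v, t.realize v = f v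

section

variable {α β : Type}

theorem IsTermFun.proj (i : α) : IsTermFun fun v : α → ℕ => v i := ⟨.var i, fun _ => rfl⟩

theorem IsTermFun.const (n : ℕ) : IsTermFun fun _ : α → ℕ => n := ⟨numeral n, realize_numeral n⟩

theorem IsTermFun.add {f g : (α → ℕ) → ℕ} (hf : IsTermFun f) (hg : IsTermFun g) :
    IsTermFun fun v => f v + g v := by
  obtain ⟨s, hs⟩ := hf
  obtain ⟨t, ht⟩ := hg
  refine ⟨tAdd s t, fun v => ?_⟩
  refine Term.realize_functions_apply₂.trans ?_
  rw [hs, ht]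
  rfl

theorem IsTermFun.mul {f g : (α → ℕ) → ℕ} (hf : IsTermFun f) (hg : IsTermFun g) :
    IsTermFun fun v => f v * g v := by
  obtain ⟨s, hs⟩ := hf
  obtain ⟨t, ht⟩ := hg
  refine ⟨tMul s t, fun v => ?_⟩
  refine Term.realize_functions_apply₂.trans ?_
  rw [hs, ht]
  rfl

theorem IsTermFun.comp_some {f : (α → ℕ) → ℕ} (hf : IsTermFun f) :
    IsTermFun fun w : Option α → ℕ => f fun i => w (some i) := by
  obtain ⟨t, ht⟩ := hf
  exact ⟨t.relabel some, fun v => Term.realize_relabel.trans (ht _)⟩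

theorem Arithmetical.of_iff {p q : (α → ℕ) → Prop} (hp : Arithmetical p) (h : ∀ v, q v ↔ p v) :
    Arithmetical q := by
  obtain ⟨φ, hφ⟩ := hp
  exact ⟨φ, fun v => (hφ v).trans (h v).symm⟩

theorem Arithmetical.eq {f g : (α → ℕ) → ℕ} (hf : IsTermFun f) (hg : IsTermFun g) :
    Arithmetical fun v => f v = g v := by
  obtain ⟨s, hs⟩ := hf
  obtain ⟨t, ht⟩ := hg
  exact ⟨s.equal t, fun v => by rw [Formula.realize_equal, hs, ht]⟩

theorem Arithmetical.not {p : (α → ℕ) → Prop} (hp : Arithmetical p) :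
    Arithmetical fun v => ¬p v := by
  obtain ⟨φ, hφ⟩ := hp
  exact ⟨φ.not, fun v => by rw [Formula.realize_not, hφ]⟩

theorem Arithmetical.and {p q : (α → ℕ) → Prop} (hp : Arithmetical p) (hq : Arithmetical q) :
    Arithmetical fun v => p v ∧ q v := by
  obtain ⟨φ, hφ⟩ := hp
  obtain ⟨ψ, hψ⟩ := hq
  exact ⟨φ ⊓ ψ, fun v => by rw [Formula.realize_inf, hφ, hψ]⟩

theorem Arithmetical.or {p q : (α → ℕ) → Prop} (hp : Arithmetical p) (hq : Arithmetical q) :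
    Arithmetical fun v => p v ∨ q v :=
  (hp.not.and hq.not).not.of_iff fun v => by tauto

theorem Arithmetical.imp {p q : (α → ℕ) → Prop} (hp : Arithmetical p) (hq : Arithmetical q) :
    Arithmetical fun v => p v → q v :=
  (hp.not.or hq).of_iff fun v => by tauto

/-- Existential quantification: the new variable of the matrix is `none`. -/
theorem Arithmetical.ex {p : (α → ℕ) → ℕ → Prop}
    (hp : Arithmetical fun w : Option α → ℕ => p (fun i => w (some i)) (w none)) :
    Arithmetical fun v => ∃ a, p v a := by
  obtain ⟨φ, hφ⟩ := hp
  let g : Option α → α ⊕ Fin 1 := fun o => o.elim (Sum.inr 0) Sum.inl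
  refine ⟨(BoundedFormula.relabel (n := 1) (k := 0) g φ).ex, fun v => ?_⟩
  rw [Formula.Realize, BoundedFormula.realize_ex]
  refine exists_congr fun a => ?_
  refine BoundedFormula.realize_relabel.trans ?_
  refine Iff.trans (iff_of_eq (congrArg (BoundedFormula.Realize φ _) (Subsingleton.elim _ _)))
    ((hφ _).trans ?_)
  exact Iff.rfl

theorem Arithmetical.all {p : (α → ℕ) → ℕ → Prop}
    (hp : Arithmetical fun w : Option α → ℕ => p (fun i => w (some i)) (w none)) :
    Arithmetical fun v => ∀ a, p v a :=
  (Arithmetical.ex (p := fun v a => ¬p v a) hp.not).not.of_iff fun v => by simp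

theorem Arithmetical.subst {p : (β → ℕ) → Prop} (hp : Arithmetical p) {f : β → (α → ℕ) → ℕ}
    (hf : ∀ i, IsTermFun (f i)) : Arithmetical fun v => p fun i => f i v := by
  obtain ⟨φ, hφ⟩ := hp
  choose t ht using hf
  refine ⟨BoundedFormula.subst φ t, fun v => BoundedFormula.realize_subst.trans ?_⟩
  simp only [ht]
  exact hφ _

theorem Arithmetical.lt {f g : (α → ℕ) → ℕ} (hf : IsTermFun f) (hg : IsTermFun g) :
    Arithmetical fun v => f v < g v := by
  refine (Arithmetical.ex (p := fun v a => f v + a + 1 = g v)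
    (.eq ((hf.comp_some.add (.proj none)).add (.const 1)) hg.comp_some)).of_iff fun v => ?_
  exact ⟨fun h => ⟨g v - f v - 1, by omega⟩, by rintro ⟨a, ha⟩; omega⟩

theorem Arithmetical.eq_pair {f g h : (α → ℕ) → ℕ} (hf : IsTermFun f) (hg : IsTermFun g)
    (hh : IsTermFun h) : Arithmetical fun v => h v = Nat.pair (f v) (g v) := by
  refine (((Arithmetical.lt hf hg).and (.eq hh ((hg.mul hg).add hf))).or
    ((Arithmetical.lt hf hg).not.and (.eq hh (((hf.mul hf).add hf).add hg)))).of_iff fun v => ?_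
  rw [Nat.pair]
  split_ifs with h <;> simp [h]

/-- Where `g` does not vanish, `h v < g v` is part of what `h v = f v % g v` says. -/
theorem Arithmetical.eq_mod {f g h : (α → ℕ) → ℕ} (hf : IsTermFun f) (hg : IsTermFun g)
    (hh : IsTermFun h) : Arithmetical fun v => h v < g v ∧ h v = f v % g v := by
  refine ((Arithmetical.lt hh hg).and (Arithmetical.ex (p := fun v a => f v = g v * a + h v)
    (.eq hf.comp_some ((hg.comp_some.mul (.proj none)).add hh.comp_some)))).of_iff fun v => ?_
  refine and_congr_right fun hlt => ⟨fun h => ⟨f v / g v, ?_⟩, ?_⟩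
  · rw [h, Nat.div_add_mod]
  · rintro ⟨a, ha⟩
    rw [ha, Nat.mul_add_mod, Nat.mod_eq_of_lt hlt]

theorem Arithmetical.eq_beta {f g h : (α → ℕ) → ℕ} (hf : IsTermFun f) (hg : IsTermFun g)
    (hh : IsTermFun h) : Arithmetical fun v => h v = Nat.beta (f v) (g v) := by
  refine (Arithmetical.ex (p := fun v a => ∃ b, f v = Nat.pair a b ∧
      (h v < (g v + 1) * b + 1 ∧ h v = a % ((g v + 1) * b + 1)))
    (Arithmetical.ex (p := fun (w : Option α → ℕ) b =>
      f (fun i => w (some i)) = Nat.pair (w none) b ∧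
      (h (fun i => w (some i)) < (g (fun i => w (some i)) + 1) * b + 1 ∧
        h (fun i => w (some i)) = w none % ((g (fun i => w (some i)) + 1) * b + 1)))
    ((Arithmetical.eq_pair (.proj (some none)) (.proj none) hf.comp_some.comp_some).and
      (Arithmetical.eq_mod (.proj (some none))
        (((hg.comp_some.comp_some.add (.const 1)).mul (.proj none)).add (.const 1))
        hh.comp_some.comp_some)))).of_iff fun v => ?_
  rw [Nat.beta]
  constructor
  · intro hv
    refine ⟨(f v).unpair.1, (f v).unpair.2, (Nat.pair_unpair _).symm, ?_, hv⟩
    rw [hv]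
    exact Nat.mod_lt _ (Nat.succ_pos _)
  · rintro ⟨a, b, hab, -, hv⟩
    rw [hab, Nat.unpair_pair]
    exact hv

end

/-! ### The graphs of partial recursive functions -/

/-- The graph of a partial function is arithmetical. -/
def ArithmeticalGraph (f : ℕ →. ℕ) : Prop :=
  Arithmetical fun v : Fin 2 → ℕ => v 1 ∈ f (v 0)

theorem ArithmeticalGraph.mem {f : ℕ →. ℕ} (h : ArithmeticalGraph f) {α : Type}
    {x y : (α → ℕ) → ℕ} (hx : IsTermFun x) (hy : IsTermFun y) :
    Arithmetical fun v => y v ∈ f (x v) :=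
  Arithmetical.subst h (f := ![x, y]) fun i => by
    fin_cases i
    · exact hx
    · exact hy

/-- A finite sequence of numbers can be coded by a number, with `Nat.beta` reading its entries. -/
theorem exists_beta (s : ℕ → ℕ) (n : ℕ) : ∃ c, ∀ i ≤ n, Nat.beta c i = s i := by
  refine ⟨Nat.unbeta (List.ofFn fun i : Fin (n + 1) => s i), fun i hi => ?_⟩
  have := Nat.beta_unbeta_coe (List.ofFn fun i : Fin (n + 1) => s i)
    ⟨i, by simpa using Nat.lt_succ_of_le hi⟩
  simpa only [List.getElem_ofFn, Fin.getElem_fin] using this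

/-- The values of a recursion, in terms of the code of the sequence of all values up to the one
sought. -/
theorem mem_natRec_iff {a : Part ℕ} {g : ℕ → ℕ → Part ℕ} {n y : ℕ} :
    y ∈ (Nat.rec a (fun m r => r.bind fun i => g m i) n : Part ℕ) ↔
      ∃ c, Nat.beta c 0 ∈ a ∧ (∀ m < n, Nat.beta c (m + 1) ∈ g m (Nat.beta c m)) ∧
        y = Nat.beta c n := by
  constructor
  · intro h
    obtain ⟨s, h0, hs, rfl⟩ : ∃ s : ℕ → ℕ, s 0 ∈ a ∧ (∀ m < n, s (m + 1) ∈ g m (s m)) ∧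
        y = s n := by
      induction n generalizing y with
      | zero => exact ⟨fun _ => y, h, by simp, rfl⟩
      | succ n ih =>
        obtain ⟨z, hz, hy⟩ := Part.mem_bind_iff.1 h
        obtain ⟨s, h0, hs, rfl⟩ := ih hz
        refine ⟨Function.update s (n + 1) y, by simpa using h0, fun m hm => ?_, by simp⟩
        rcases Nat.lt_succ_iff_lt_or_eq.1 hm with hm | rfl
        · rw [Function.update_of_ne (by omega), Function.update_of_ne (by omega)]
          exact hs m hm
        · simpa using hy
    obtain ⟨c, hc⟩ := exists_beta s n
    refine ⟨c, by rwa [hc 0 (Nat.zero_le _)], fun m hm => ?_, (hc n le_rfl).symm⟩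
    rw [hc _ hm, hc _ hm.le]
    exact hs m hm
  · rintro ⟨c, h0, hs, rfl⟩
    induction n with
    | zero => exact h0
    | succ n ih =>
      exact Part.mem_bind_iff.2 ⟨_, ih fun m hm => hs m (Nat.lt_succ_of_lt hm),
        hs n (Nat.lt_succ_self n)⟩

theorem arithmeticalGraph_of_partrec {f : ℕ →. ℕ} (hf : Nat.Partrec f) : ArithmeticalGraph f := by
  induction hf with
  | zero =>
    exact (Arithmetical.eq (.proj 1) (.const 0)).of_iff fun v => by simp [pure, PFun.pure]
  | succ =>
    exact (Arithmetical.eq (.proj 1) ((IsTermFun.proj 0).add (.const 1))).of_iff fun v => by simp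
  | left =>
    refine (Arithmetical.ex (p := fun (v : Fin 2 → ℕ) b => v 0 = Nat.pair (v 1) b)
      (.eq_pair (.proj _) (.proj _) (.proj _))).of_iff fun v => ?_
    simp only [PFun.coe_val, Part.mem_some_iff]
    constructor
    · intro h
      exact ⟨(v 0).unpair.2, by rw [h, Nat.pair_unpair]⟩
    · rintro ⟨b, hb⟩
      rw [hb, Nat.unpair_pair]
  | right =>
    refine (Arithmetical.ex (p := fun (v : Fin 2 → ℕ) b => v 0 = Nat.pair b (v 1))
      (.eq_pair (.proj _) (.proj _) (.proj _))).of_iff fun v => ?_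
    simp only [PFun.coe_val, Part.mem_some_iff]
    constructor
    · intro h
      exact ⟨(v 0).unpair.1, by rw [h, Nat.pair_unpair]⟩
    · rintro ⟨b, hb⟩
      rw [hb, Nat.unpair_pair]
  | @pair f g _ _ ihf ihg =>
    refine (Arithmetical.ex (p := fun (v : Fin 2 → ℕ) a => ∃ b, a ∈ f (v 0) ∧ b ∈ g (v 0) ∧
        v 1 = Nat.pair a b)
      (Arithmetical.ex (p := fun (w : Option (Fin 2) → ℕ) b => w none ∈ f (w (some 0)) ∧
        b ∈ g (w (some 0)) ∧ w (some 1) = Nat.pair (w none) b)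
      ((ihf.mem (.proj _) (.proj _)).and ((ihg.mem (.proj _) (.proj _)).and
        (.eq_pair (.proj _) (.proj _) (.proj _)))))).of_iff fun v => ?_
    simp [Seq.seq, eq_comm]
  | @comp f g _ _ ihf ihg =>
    refine (Arithmetical.ex (p := fun (v : Fin 2 → ℕ) a => a ∈ g (v 0) ∧ v 1 ∈ f a)
      ((ihg.mem (.proj _) (.proj _)).and (ihf.mem (.proj _) (.proj _)))).of_iff fun v => ?_
    exact Part.mem_bind_iff
  | @prec f g _ _ ihf ihg =>
    have hstep : Arithmetical fun w : Fin 3 → ℕ => ∃ y z u q, y = Nat.beta (w 0) (w 2) ∧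
        z = Nat.beta (w 0) (w 2 + 1) ∧ u = Nat.pair (w 2) y ∧ q = Nat.pair (w 1) u ∧ z ∈ g q :=
      .ex (.ex (.ex (.ex ((Arithmetical.eq_beta (.proj (some (some (some (some 0)))))
        (.proj (some (some (some (some 2))))) (.proj (some (some (some none))))).and
        ((Arithmetical.eq_beta (.proj (some (some (some (some 0)))))
          ((IsTermFun.proj (some (some (some (some 2))))).add (.const 1))
          (.proj (some (some none)))).and
        ((Arithmetical.eq_pair (.proj _) (.proj _) (.proj _)).and
        ((Arithmetical.eq_pair (.proj _) (.proj _) (.proj _)).and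
          (ihg.mem (.proj _) (.proj _)))))))))
    replace hstep : Arithmetical fun w : Fin 3 → ℕ =>
        Nat.beta (w 0) (w 2 + 1) ∈ g (Nat.pair (w 1) (Nat.pair (w 2) (Nat.beta (w 0) (w 2)))) :=
      hstep.of_iff fun w => by simp
    have h : Arithmetical fun v : Fin 2 → ℕ => ∃ a n c z, v 0 = Nat.pair a n ∧
        z = Nat.beta c 0 ∧ z ∈ f a ∧ (∀ m, m < n → Nat.beta c (m + 1) ∈
          g (Nat.pair a (Nat.pair m (Nat.beta c m)))) ∧ v 1 = Nat.beta c n :=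
      .ex (.ex (.ex (.ex ((Arithmetical.eq_pair (.proj (some (some (some none))))
          (.proj (some (some none))) (.proj (some (some (some (some 0)))))).and
        ((Arithmetical.eq_beta (.proj (some none)) (.const 0) (.proj none)).and
        ((ihf.mem (.proj (some (some (some none)))) (.proj none)).and
        ((Arithmetical.all (.imp (.lt (.proj none) (.proj (some (some (some none)))))
          (hstep.subst (f := ![fun w => w (some (some none)),
            fun w => w (some (some (some (some none)))), fun w => w none])
            fun i => by fin_cases i <;> exact .proj _))).and
        (Arithmetical.eq_beta (.proj (some none)) (.proj (some (some none)))
          (.proj (some (some (some (some 1)))))))))))))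
    refine h.of_iff fun v => ?_
    simp only [Nat.unpaired]
    refine mem_natRec_iff.trans ?_
    constructor
    · rintro ⟨c, h0, hs, hy⟩
      exact ⟨_, _, c, _, (Nat.pair_unpair _).symm, rfl, h0, hs, hy⟩
    · rintro ⟨a, n, c, _, hv, rfl, h0, hs, hy⟩
      rw [hv, Nat.unpair_pair]
      exact ⟨c, h0, hs, hy⟩
  | @rfind f _ ih =>
    have h : Arithmetical fun v : Fin 2 → ℕ => ∃ q z, q = Nat.pair (v 0) (v 1) ∧ z = 0 ∧ z ∈ f q ∧
        ∀ m, m < v 1 → ∃ r u, r = Nat.pair (v 0) m ∧ u ∈ f r ∧ ¬u = 0 :=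
      .ex (.ex ((Arithmetical.eq_pair (.proj _) (.proj _) (.proj _)).and
        ((Arithmetical.eq (.proj _) (.const 0)).and ((ih.mem (.proj _) (.proj _)).and
        (.all (.imp (.lt (.proj _) (.proj _)) (.ex (.ex
          ((Arithmetical.eq_pair (.proj _) (.proj _) (.proj _)).and
          ((ih.mem (.proj _) (.proj _)).and (Arithmetical.eq (.proj _) (.const 0)).not))))))))))
    refine h.of_iff fun v => ?_
    refine Nat.mem_rfind.trans ?_
    simp

/-- A recursively enumerable set is the projection of an arithmetical graph; `P` is the negation of
the formula that says so. -/
theorem exists_expresses_compl {K : Set ℕ} (hK : IsRecursivelyEnumerable K) :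
    ∃ P : arith.Formula (Fin 1), Expresses P Kᶜ := by
  obtain ⟨f, hf, rfl⟩ := hK
  have h : Arithmetical fun v : Fin 1 → ℕ => ¬∃ m, v 0 ∈ f m :=
    (Arithmetical.ex (p := fun v m => v 0 ∈ f m)
      ((arithmeticalGraph_of_partrec hf).mem (.proj _) (.proj _))).not
  obtain ⟨P, hP⟩ := h
  refine ⟨P, fun n => ?_⟩
  rw [models_instanceAt, hP]
  rfl

/-! ### The halting set -/

theorem isRecursivelyEnumerable_haltingSet : IsRecursivelyEnumerable haltingSet := by
  rw [isRecursivelyEnumerable_iff]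
  have h : Partrec fun m : ℕ => partialRecursive m.unpair.1 m.unpair.2 :=
    Nat.Partrec.Code.eval_part.comp
      ((Computable.ofNat Nat.Partrec.Code).comp (Computable.fst.comp Computable.unpair))
      (Computable.snd.comp Computable.unpair)
  refine h.dom_re.of_eq fun m => ⟨fun hm => ⟨_, _, hm, Nat.pair_unpair m⟩, ?_⟩
  rintro ⟨n, x, hx, rfl⟩
  rwa [Nat.unpair_pair]

theorem not_isRecursivelyEnumerable_compl_haltingSet :
    ¬IsRecursivelyEnumerable haltingSetᶜ := by
  rw [isRecursivelyEnumerable_iff]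
  intro h
  refine ComputablePred.halting_problem_not_re 0 ?_
  have hc : Computable fun c : Nat.Partrec.Code => Nat.pair (Encodable.encode c) 0 :=
    (Primrec₂.natPair.comp Primrec.encode (Primrec.const 0)).to_comp
  refine REPred.of_eq (p := fun c => Nat.pair (Encodable.encode c) 0 ∈ haltingSetᶜ)
    (Partrec.comp h hc) fun c => not_congr ⟨?_, fun hd => ?_⟩
  · rintro ⟨n, x, hx, hp⟩
    obtain ⟨rfl, rfl⟩ := Nat.pair_eq_pair.1 hp
    simpa [partialRecursive] using hx
  · exact ⟨_, 0, by simpa [partialRecursive] using hd, rfl⟩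

end PeanoIncompleteness

theorem mainTheorem3 :
    (PeanoIncompleteness.IsRecursivelyEnumerable PeanoIncompleteness.haltingSet ∧
      ¬ PeanoIncompleteness.IsRecursivelyEnumerable PeanoIncompleteness.haltingSetᶜ) ∧
    ∀ K : Set ℕ, PeanoIncompleteness.IsRecursivelyEnumerable K →
      ¬ PeanoIncompleteness.IsRecursivelyEnumerable Kᶜ →
      (∃ P : PeanoIncompleteness.arith.Formula (Fin 1), PeanoIncompleteness.Expresses P Kᶜ) ∧
      ∀ P : PeanoIncompleteness.arith.Formula (Fin 1), PeanoIncompleteness.Expresses P Kᶜ →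
        ∃ n₀ : ℕ, n₀ ∉ K ∧
          ¬ PeanoIncompleteness.PAProves (PeanoIncompleteness.instanceAt P n₀) := by
  refine ⟨⟨PeanoIncompleteness.isRecursivelyEnumerable_haltingSet,
    PeanoIncompleteness.not_isRecursivelyEnumerable_compl_haltingSet⟩, fun K hK hKc =>
    ⟨PeanoIncompleteness.exists_expresses_compl hK, fun P hP => ?_⟩⟩
  -- otherwise the derivable instances of `P` are exactly those at members of `Kᶜ`
  by_contra! hall
  obtain ⟨p, hp, hprov, htrue⟩ := PeanoIncompleteness.exists_rePred_between P
  refine hKc (PeanoIncompleteness.isRecursivelyEnumerable_iff.2 (hp.of_eq fun n => ?_))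
  exact ⟨fun h => (hP n).1 (htrue n h), fun h => hprov n (hall n h)⟩
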